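/- **Theorem 1.** There exist absolute constants $c,c'>0$ such that the following holds. Let $\|\cdot\|$ be a norm on $\mathbb{R}^d$, let $X$ be a random vector in $\mathbb{R}^d$ with $\mathbb{E}\|X\|_2^2<\infty$ (i.e. with a mean $\mu$ and a covariance matrix $\Sigma$), let $\delta\in(0,1)$, put $n=\lceil\log(2/\delta)\rceil$, let $N\ge n$, and let $X_1,\dots,X_N$ be independent copies of $X$. Let $I_1,\dots,I_n\subset\{1,\dots,N\}$ be any fixed pairwise disjoint blocks of cardinality $m=\lfloor N/n\rfloor$ (if $n$ divides $N$, this is a splitting of the whole sample into $n$ blocks of size $N/n$), and let $Z_j=\frac1m\sum_{i\in I_j}X_i$. Let $\mathcal{B}^\circ=\{t\in\mathbb{R}^d:\langle t,x\rangle\le 1\text{ whenever }\|x\|\le 1\}$ be the unit ball of the dual norm, where $t\in\mathbb{R}^d$ is identified with the functional $x\mapsto\langle t,x\rangle$. For $\epsilon\ge 0$ and an extreme point $x^*$ of $\mathcal{B}^\circ$ set $$S_{x^*}=\Big\{y\in\mathbb{R}^d:\ |x^*(Z_j)-x^*(y)|\le \tfrac{\epsilon}{2}\ \text{ for more than } \tfrac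 n2 \text{ indices } j\Big\},\qquad \mathbb{S}(\epsilon)=\bigcap_{x^*\in\mathrm{ext}(\mathcal{B}^\circ)}S_{x^*}.$$ Let $Y_N=\frac1{\sqrt N}\sum_{i=1}^N\varepsilon_i(X_i-\mu)$, where $\varepsilon_1,\dots,\varepsilon_N$ are independent symmetric $\{-1,1\}$-valued random variables independent of $(X_i)_{i=1}^N$, let $G$ be the centred Gaussian vector with covariance matrix $\Sigma$, and let $R=\sup_{x^*\in\mathcal{B}^\circ}\big(\mathbb{E}\,(x^*(X-\mu))^2\big)^{1/2}$. If $$\epsilon\ \ge\ \frac{c}{\sqrt N}\,\max\Big\{\mathbb{E}\|Y_N\|,\ \ \mathbb{E}\|G\|+R\sqrt{\log(2/\delta)}\Big\},$$ then, with probability at least $1-c'\delta$, the set $\mathbb{S}(\epsilon)$ is nonempty and every point $\hat\mu\in\mathbb{S}(\epsilon)$ satisfies $\|\hat\mu-\mu\|\le\epsilon$. -/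

import Mathlib

open MeasureTheory ProbabilityTheory

noncomputable section

namespace NormMean

variable {d N n : ℕ}

/-- The unit ball of the dual norm of `p` on `ℝ^d`. A linear functional is identified with the
point `t` of `ℝ^d` that represents it, its action being `x ↦ ⟪t, x⟫`. -/
def dualBall (p : Seminorm ℝ (EuclideanSpace ℝ (Fin d))) : Set (EuclideanSpace ℝ (Fin d)) :=
  {t | ∀ x, p x ≤ 1 → inner ℝ t x ≤ 1}

/-- The number of blocks: `log (2 / δ)`, rounded up to an integer. -/
def numBlocks (δ : ℝ) : ℕ := ⌈Real.log (2 / δ)⌉₊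

/-- `I` is a family of `n` pairwise disjoint blocks of sample indices, each of cardinality
`N / n` (rounded down). If `n` divides `N`, this is a partition of the sample. -/
structure IsBlockFamily (I : Fin n → Finset (Fin N)) : Prop where
  card_eq : ∀ j, (I j).card = N / n
  disjoint : ∀ j k, j ≠ k → Disjoint (I j) (I k)

/-- The empirical mean of the sample `x` over the block `J`. -/
def blockMean (x : Fin N → EuclideanSpace ℝ (Fin d)) (J : Finset (Fin N)) :
    EuclideanSpace ℝ (Fin d) :=
  (J.card : ℝ)⁻¹ • ∑ i ∈ J, x i

open Classical in
/-- The points `y` such that `|⟪t, Z_j⟫ - ⟪t, y⟫| ≤ r` for more than half of the blocks `I_j`,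
where `Z_j` is the empirical mean over `I_j`. -/
def slabSet (r : ℝ) (I : Fin n → Finset (Fin N)) (x : Fin N → EuclideanSpace ℝ (Fin d))
    (t : EuclideanSpace ℝ (Fin d)) : Set (EuclideanSpace ℝ (Fin d)) :=
  {y | (n : ℝ) / 2 <
    ((Finset.univ.filter fun j : Fin n => |inner ℝ t (blockMean x (I j)) - inner ℝ t y| ≤ r).card : ℝ)}

/-- The intersection of the sets `slabSet r I x t` over all extreme points `t` of the dual unit
ball of `p`. -/
def slabIntersection (p : Seminorm ℝ (EuclideanSpace ℝ (Fin d))) (r : ℝ)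
    (I : Fin n → Finset (Fin N)) (x : Fin N → EuclideanSpace ℝ (Fin d)) :
    Set (EuclideanSpace ℝ (Fin d)) :=
  ⋂ t ∈ Set.extremePoints ℝ (dualBall p), slabSet r I x t

/-- The mean of the law `ν`. -/
def mean (ν : Measure (EuclideanSpace ℝ (Fin d))) : EuclideanSpace ℝ (Fin d) := ∫ x, x ∂ν

/-- The covariance matrix of the law `ν`. -/
def covMatrix (ν : Measure (EuclideanSpace ℝ (Fin d))) : Matrix (Fin d) (Fin d) ℝ :=
  Matrix.of fun i j => ∫ x, (x i - mean ν i) * (x j - mean ν j) ∂ν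

/-- The law of a symmetric random sign. -/
def rademacher : Measure ℝ :=
  (2⁻¹ : ENNReal) • Measure.dirac 1 + (2⁻¹ : ENNReal) • Measure.dirac (-1)

/-- `E ‖Y_N‖`, where `Y_N = N ^ (-1/2) ∑ i, ε_i (X_i - μ)` with independent random signs `ε_i` and
independent `X_i` of law `ν`, also independent of the signs. -/
def expNormY (p : Seminorm ℝ (EuclideanSpace ℝ (Fin d)))
    (ν : Measure (EuclideanSpace ℝ (Fin d))) (N : ℕ) : ℝ :=
  ∫ z : (Fin N → ℝ) × (Fin N → EuclideanSpace ℝ (Fin d)),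
    p ((Real.sqrt N)⁻¹ • ∑ i, z.1 i • (z.2 i - mean ν))
    ∂((Measure.pi fun _ => rademacher).prod (Measure.pi fun _ => ν))

/-- `E ‖G‖`, where `G` is the centred Gaussian vector with the same covariance matrix as `ν`. -/
def expNormG (p : Seminorm ℝ (EuclideanSpace ℝ (Fin d)))
    (ν : Measure (EuclideanSpace ℝ (Fin d))) : ℝ :=
  ∫ g, p g ∂(multivariateGaussian 0 (covMatrix ν))

/-- `R`, the supremum over the dual unit ball of the standard deviations of the functionals. -/
def weakStd (p : Seminorm ℝ (EuclideanSpace ℝ (Fin d)))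
    (ν : Measure (EuclideanSpace ℝ (Fin d))) : ℝ :=
  sSup ((fun t => Real.sqrt (∫ x, inner ℝ t (x - mean ν) ^ 2 ∂ν)) '' dualBall p)

end NormMean

end

namespace NormMean

/-! ### Suprema over an uncountable index set -/

section Suprema

/-! Call a block bad for a functional `t` of the dual ball when its mean deviates from `μ` along `t`
by more than `ε / 2`. If every `t` has fewer than half of the blocks bad, then `μ` lies in every
slab, and any other point of the intersection shares a good block with `μ` for each extreme `t`. By
Krein–Milman the extreme functionals determine the norm, so that point is within `ε` of `μ`
(`mem_slabIntersection_and_forall_le`). It remains to bound by `δ` the probability of `manyBad`,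
that some `t` has at least half of the blocks bad.

First moment (`integral_supDeviation_le`). Consider the expectation of `sup_t ∑ j, |t(Z_j - μ)|`.
The means of the summands cost at most `n R / √m`, by the variance of a block mean. The centred part
is handled by symmetrization over blocks, contraction to remove the absolute values, and a second
symmetrization from block signs to individual signs; it costs `4 m⁻¹ √N E‖Y_N‖`. The total is a
small multiple of `n ε`; `E‖G‖` enters only through its nonnegativity.

From expectation to exponential probability (`measure_manyBad_mul_measure_fewBad_le`). Add `q`
independent ghost samples. By Markov, with probability at least `1/2` every `t` has fewer than `n /
4` bad blocks in all of them together (`fewBad`). Now choose in each block which of the `q + 1`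
copies plays the true sample. All `(q + 1) ^ n` choices give the event "many bad in the chosen
sample, few in the rest" the same probability, while any two choices realizing it at the same point
agree on at least a quarter of the blocks. With `q + 1 = b ^ 4`, such choices form a fraction at
most `(2 / b) ^ n`. Taking `b = 6` yields probability at most `2 · 3⁻ⁿ ≤ δ`. -/

theorem abs_iSup_le_of_abs_le {T : Type*} [Nonempty T] {h : T → ℝ} {B : ℝ}
    (hB : ∀ t, |h t| ≤ B) : |⨆ t, h t| ≤ B := by
  refine abs_le.2 ⟨?_, ciSup_le fun t => (abs_le.1 (hB t)).2⟩
  obtain ⟨t⟩ := ‹Nonempty T›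
  exact (abs_le.1 (hB t)).1.trans
    (le_ciSup (f := h) ⟨B, by rintro _ ⟨t, rfl⟩; exact (abs_le.1 (hB t)).2⟩ t)

theorem bddAbove_range_of_abs_le {T : Type*} {h : T → ℝ} {B : ℝ} (hB : ∀ t, |h t| ≤ B) :
    BddAbove (Set.range h) :=
  ⟨B, by rintro _ ⟨t, rfl⟩; exact (abs_le.1 (hB t)).2⟩

/-- A supremum of continuous functions with a common integrable bound is integrable. -/
theorem integrable_iSup {T Y : Type*} [Nonempty T] [TopologicalSpace Y] [MeasurableSpace Y]
    [OpensMeasurableSpace Y] {μ : Measure Y} {h : T → Y → ℝ} {B : Y → ℝ}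
    (hc : ∀ t, Continuous (h t)) (hB : ∀ t y, |h t y| ≤ B y) (hi : Integrable B μ) :
    Integrable (fun y => ⨆ t, h t y) μ := by
  refine hi.mono' ?_ (Filter.Eventually.of_forall fun y => ?_)
  · exact (lowerSemicontinuous_ciSup
      (fun y => bddAbove_range_of_abs_le fun t => hB t y)
      fun t => (hc t).lowerSemicontinuous).measurable.aestronglyMeasurable
  · exact abs_iSup_le_of_abs_le fun t => hB t y

end Suprema

/-! ### Contraction principle for the absolute value -/

section Contraction

/-- For points `t`, `t'` of the two suprema on the left, the sign of `a t` decides which supremum on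
the right bounds the first term; the other one bounds the second, because `-|a t'|` is below both `a
t'` and `-a t'`. -/
theorem iSup_add_abs_add_iSup_sub_abs_le {T : Type*} [Nonempty T] {u a : T → ℝ} {B : ℝ}
    (hu : ∀ t, |u t| + |a t| ≤ B) :
    (⨆ t, (u t + |a t|)) + (⨆ t, (u t - |a t|)) ≤ (⨆ t, (u t + a t)) + ⨆ t, (u t - a t) := by
  have b1 : BddAbove (Set.range fun t => u t + a t) :=
    bddAbove_range_of_abs_le fun t => (abs_add_le _ _).trans (hu t)
  have b2 : BddAbove (Set.range fun t => u t - a t) :=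
    bddAbove_range_of_abs_le fun t => (abs_sub _ _).trans (hu t)
  refine ciSup_add_ciSup_le fun t t' => ?_
  have h1 := le_ciSup b1 t
  have h2 := le_ciSup b2 t
  have h3 := le_ciSup b1 t'
  have h4 := le_ciSup b2 t'
  rcases abs_cases (a t) with h | h <;> rcases abs_cases (a t') with h' | h' <;> linarith

/-- Contraction principle for the absolute value, with the average over all sign vectors. -/
theorem sum_iSup_sign_abs_le {T ι : Type*} [Nonempty T] [Fintype ι] [DecidableEq ι]
    {a : T → ι → ℝ} {B : ι → ℝ} (ha : ∀ t j, |a t j| ≤ B j) :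
    ∑ s : ι → ℤˣ, ⨆ t, ∑ j, ((s j : ℤ) : ℝ) * |a t j| ≤
      ∑ s : ι → ℤˣ, ⨆ t, ∑ j, ((s j : ℤ) : ℝ) * a t j := by
  -- Absolute values are inserted one coordinate at a time. For the new coordinate `k`, each sign
  -- vector is paired with its flip at `k`, and the two-point inequality applies to the pair.
  have key : ∀ J : Finset ι,
      ∑ s : ι → ℤˣ, ⨆ t, ∑ j, ((s j : ℤ) : ℝ) * (if j ∈ J then |a t j| else a t j) ≤
      ∑ s : ι → ℤˣ, ⨆ t, ∑ j, ((s j : ℤ) : ℝ) * a t j := by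
    intro J
    induction J using Finset.induction_on with
    | empty => simp
    | insert k J hk ih =>
      refine le_trans ?_ ih
      have flip : ∀ F : (ι → ℤˣ) → ℝ,
          ∑ s, F s = ∑ s, F (Function.update s k (-s k)) := by
        intro F
        have hinv : Function.Involutive fun s : ι → ℤˣ => Function.update s k (-s k) := by
          intro s; simp
        exact (Equiv.sum_comp hinv.toPerm F).symm
      set F : (ι → ℤˣ) → ℝ := fun s => ⨆ t, ∑ j, ((s j : ℤ) : ℝ) *
        (if j ∈ insert k J then |a t j| else a t j) with hF
      set G : (ι → ℤˣ) → ℝ := fun s => ⨆ t, ∑ j, ((s j : ℤ) : ℝ) *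
        (if j ∈ J then |a t j| else a t j) with hG
      have step : ∀ s, F s + F (Function.update s k (-s k)) ≤
          G s + G (Function.update s k (-s k)) := by
        intro s
        set u : T → ℝ := fun t => ∑ j ∈ Finset.univ.erase k, ((s j : ℤ) : ℝ) *
          (if j ∈ J then |a t j| else a t j) with hu
        have e1 : ∀ (s' : ι → ℤˣ), (∀ j ≠ k, s' j = s j) →
            F s' = ⨆ t, (u t + ((s' k : ℤ) : ℝ) * |a t k|) := by
          intro s' hs'
          refine iSup_congr fun t => ?_
          rw [← Finset.sum_erase_add _ _ (Finset.mem_univ k)]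
          simp only [Finset.mem_insert_self, if_true, hu]
          congr 1
          refine Finset.sum_congr rfl fun j hj => ?_
          have := Finset.ne_of_mem_erase hj
          rw [hs' j this]
          simp [this]
        have e2 : ∀ (s' : ι → ℤˣ), (∀ j ≠ k, s' j = s j) →
            G s' = ⨆ t, (u t + ((s' k : ℤ) : ℝ) * a t k) := by
          intro s' hs'
          refine iSup_congr fun t => ?_
          rw [← Finset.sum_erase_add _ _ (Finset.mem_univ k)]
          simp only [hk, if_false, hu]
          congr 1
          refine Finset.sum_congr rfl fun j hj => ?_
          rw [hs' j (Finset.ne_of_mem_erase hj)]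
        have hup : ∀ j ≠ k, Function.update s k (-s k) j = s j := fun j hj => by simp [hj]
        rw [e1 s fun _ _ => rfl, e2 s fun _ _ => rfl, e1 _ hup, e2 _ hup]
        have hbd : ∀ t, |u t| + |a t k| ≤ ∑ j, B j := by
          intro t
          rw [← Finset.sum_erase_add _ _ (Finset.mem_univ k)]
          refine add_le_add ((Finset.abs_sum_le_sum_abs _ _).trans
            (Finset.sum_le_sum fun j _ => ?_)) (ha t k)
          rcases Int.units_eq_one_or (s j) with h | h <;> rw [h] <;> split_ifs <;>
            simpa using ha t j
        have := iSup_add_abs_add_iSup_sub_abs_le hbd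
        rcases Int.units_eq_one_or (s k) with h | h <;>
          simp only [h, Function.update_self, Units.val_neg, Units.val_one, Int.cast_neg,
            Int.cast_one, one_mul, neg_mul, neg_neg, ← sub_eq_add_neg] <;> linarith
      have hsum := Finset.sum_le_sum fun s (_ : s ∈ (Finset.univ : Finset (ι → ℤˣ))) => step s
      rw [Finset.sum_add_distrib, Finset.sum_add_distrib, ← flip F, ← flip G] at hsum
      linarith
  simpa using key Finset.univ

end Contraction

/-! ### Symmetrization with fixed block signs -/

section Symmetrization

variable {κ ι E T : Type*} [Fintype κ] [Fintype ι] [MeasurableSpace E]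

/-- Exchanges the coordinates in `A` between two samples. -/
def swapOn (A : κ → Prop) [DecidablePred A] (z : (κ → E) × (κ → E)) : (κ → E) × (κ → E) :=
  (fun i => if A i then z.2 i else z.1 i, fun i => if A i then z.1 i else z.2 i)

theorem measurePreserving_swapOn (ν : Measure E) [IsProbabilityMeasure ν] (A : κ → Prop)
    [DecidablePred A] :
    MeasurePreserving (swapOn (E := E) A)
      ((Measure.pi fun _ : κ => ν).prod (Measure.pi fun _ : κ => ν))
      ((Measure.pi fun _ : κ => ν).prod (Measure.pi fun _ : κ => ν)) := by
  have e := measurePreserving_arrowProdEquivProdArrow E E κ (fun _ => ν) (fun _ => ν)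
  have h : MeasurePreserving (fun (x : κ → E × E) i => if A i then (x i).swap else x i)
      (Measure.pi fun _ : κ => ν.prod ν) (Measure.pi fun _ : κ => ν.prod ν) := by
    refine measurePreserving_pi (f := fun i (y : E × E) => if A i then y.swap else y) _ _ fun i => ?_
    by_cases hA : A i
    · simpa [hA] using Measure.measurePreserving_swap (μ := ν) (ν := ν)
    · simp only [hA, if_false]
      exact MeasurePreserving.id _
  have := e.comp (h.comp (e.symm _))
  convert this using 1
  funext z
  refine Prod.ext (funext fun i => ?_) (funext fun i => ?_) <;>
  · by_cases hA : A i <;> simp [swapOn, hA, MeasurableEquiv.arrowProdEquivProdArrow,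
      Equiv.arrowProdEquivProdArrow]

/-- Symmetrization of a supremum of centred sums over independent blocks, for fixed signs. -/
theorem integral_iSup_sum_sub_integral_le [Nonempty T] [TopologicalSpace E]
    [SecondCountableTopology E] [OpensMeasurableSpace E]
    (ν : Measure E) [IsProbabilityMeasure ν] (blk : κ → ι)
    (g : T → ι → (κ → E) → ℝ) (hc : ∀ t j, Continuous (g t j))
    (hg : ∀ t j w w', (∀ i, blk i = j → w i = w' i) → g t j w = g t j w')
    (B : ι → (κ → E) → ℝ) (hB : ∀ t j w, |g t j w| ≤ B j w)
    (hi : ∀ j, Integrable (B j) (Measure.pi fun _ : κ => ν)) (s : ι → ℤˣ) :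
    ∫ x, ⨆ t, ∑ j, (g t j x - ∫ y, g t j y ∂(Measure.pi fun _ : κ => ν))
        ∂(Measure.pi fun _ : κ => ν) ≤
      (∫ x, ⨆ t, ∑ j, ((s j : ℤ) : ℝ) * g t j x ∂(Measure.pi fun _ : κ => ν)) +
      ∫ x, ⨆ t, ∑ j, (((-s) j : ℤ) : ℝ) * g t j x ∂(Measure.pi fun _ : κ => ν) := by
  classical
  set Q := Measure.pi fun _ : κ => ν with hQ
  have hsgn : ∀ (s : ι → ℤˣ) j (r : ℝ), |((s j : ℤ) : ℝ) * r| = |r| := by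
    intro s j r
    rcases Int.units_eq_one_or (s j) with h | h <;> simp [h]
  have hgi : ∀ t j, Integrable (g t j) Q := fun t j =>
    (hi j).mono' (hc t j).measurable.aestronglyMeasurable
      (Filter.Eventually.of_forall fun x => hB t j x)
  have hBs : Integrable (fun x => ∑ j, B j x) Q := integrable_finsetSum _ fun j _ => hi j
  have hsb : ∀ (s : ι → ℤˣ) t x, |∑ j, ((s j : ℤ) : ℝ) * g t j x| ≤ ∑ j, B j x := fun s t x =>
    (Finset.abs_sum_le_sum_abs _ _).trans (Finset.sum_le_sum fun j _ => by
      rw [hsgn]; exact hB t j x)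
  have hsi : ∀ s : ι → ℤˣ, Integrable (fun x => ⨆ t, ∑ j, ((s j : ℤ) : ℝ) * g t j x) Q :=
    fun s => integrable_iSup (fun t => by fun_prop) (hsb s) hBs
  have hdb : ∀ t (x y : κ → E), |∑ j, (g t j x - g t j y)| ≤ ∑ j, B j x + ∑ j, B j y := by
    intro t x y
    rw [← Finset.sum_add_distrib]
    exact (Finset.abs_sum_le_sum_abs _ _).trans (Finset.sum_le_sum fun j _ =>
      (abs_sub _ _).trans (add_le_add (hB t j x) (hB t j y)))
  set Ψ : (κ → E) × (κ → E) → ℝ := fun z => ⨆ t, ∑ j, (g t j z.1 - g t j z.2) with hΨ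
  have hΨi : Integrable Ψ (Q.prod Q) := by
    refine integrable_iSup (B := fun z => ∑ j, B j z.1 + ∑ j, B j z.2) (fun t => ?_)
      (fun t z => hdb t z.1 z.2) ((hBs.comp_fst Q).add (hBs.comp_snd Q))
    exact continuous_finsetSum _ fun j _ =>
      ((hc t j).comp continuous_fst).sub ((hc t j).comp continuous_snd)
  -- Jensen: the expectation is replaced by an independent copy, and the supremum moves inside the
  -- integral.
  have hle : ∀ x, ⨆ t, ∑ j, (g t j x - ∫ y, g t j y ∂Q) ≤ ∫ y, Ψ (x, y) ∂Q := by
    intro x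
    have hi2 : Integrable (fun y => Ψ (x, y)) Q := by
      refine integrable_iSup (B := fun y => ∑ j, B j x + ∑ j, B j y) (fun t => by fun_prop)
        (fun t y => hdb t x y) ((integrable_const _).add hBs)
    refine ciSup_le fun t => ?_
    have : ∑ j, (g t j x - ∫ y, g t j y ∂Q) = ∫ y, ∑ j, (g t j x - g t j y) ∂Q := by
      rw [integral_finsetSum _ fun j _ => ?_]
      swap
      · exact (integrable_const (g t j x)).sub (hgi t j)
      refine Finset.sum_congr rfl fun j _ => ?_
      rw [integral_sub (integrable_const _) (hgi t j)]
      simp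
    rw [this]
    refine integral_mono (integrable_finsetSum _ fun j _ => (integrable_const _).sub (hgi t j))
      hi2 fun y => ?_
    exact le_ciSup (f := fun t => ∑ j, (g t j x - g t j y))
      (bddAbove_range_of_abs_le fun t => hdb t x y) t
  have hmb : ∀ t x, |∑ j, (g t j x - ∫ y, g t j y ∂Q)| ≤ ∑ j, B j x + ∑ j, ∫ y, B j y ∂Q := by
    intro t x
    rw [← Finset.sum_add_distrib]
    refine (Finset.abs_sum_le_sum_abs _ _).trans (Finset.sum_le_sum fun j _ =>
      (abs_sub _ _).trans (add_le_add (hB t j x) ?_))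
    exact (abs_integral_le_integral_abs).trans
      (integral_mono (hgi t j).abs (hi j) fun y => hB t j y)
  have h1 : ∫ x, ⨆ t, ∑ j, (g t j x - ∫ y, g t j y ∂Q) ∂Q ≤ ∫ z, Ψ z ∂(Q.prod Q) := by
    rw [integral_prod _ hΨi]
    exact integral_mono (integrable_iSup (fun t => by fun_prop) hmb
      (hBs.add (integrable_const _))) hΨi.integral_prod_left hle
  -- Exchanging the two samples on the blocks of sign `-1` preserves the product law and flips
  -- exactly those block differences.
  set A : κ → Prop := fun i => s (blk i) = -1 with hA
  have hmp := measurePreserving_swapOn ν A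
  have h2 : ∫ z, Ψ z ∂(Q.prod Q) = ∫ z, Ψ (swapOn A z) ∂(Q.prod Q) := by
    conv_lhs => rw [← hmp.map_eq]
    exact integral_map hmp.measurable.aemeasurable (by rw [hmp.map_eq]; exact hΨi.1)
  have h3 : ∀ z, Ψ (swapOn A z) ≤ (⨆ t, ∑ j, ((s j : ℤ) : ℝ) * g t j z.1) +
      ⨆ t, ∑ j, (((-s) j : ℤ) : ℝ) * g t j z.2 := by
    intro z
    refine ciSup_le fun t => ?_
    have e : ∑ j, (g t j (swapOn A z).1 - g t j (swapOn A z).2) =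
        ∑ j, ((s j : ℤ) : ℝ) * g t j z.1 + ∑ j, (((-s) j : ℤ) : ℝ) * g t j z.2 := by
      rw [← Finset.sum_add_distrib]
      refine Finset.sum_congr rfl fun j _ => ?_
      rcases Int.units_eq_one_or (s j) with h | h
      · rw [hg t j (swapOn A z).1 z.1, hg t j (swapOn A z).2 z.2]
        · simp [h]; ring
        · rintro i rfl; simp [swapOn, hA, h]
        · rintro i rfl; simp [swapOn, hA, h]
      · rw [hg t j (swapOn A z).1 z.2, hg t j (swapOn A z).2 z.1]
        · simp [h]; ring
        · rintro i rfl; simp [swapOn, hA, h]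
        · rintro i rfl; simp [swapOn, hA, h]
    rw [e]
    exact add_le_add
      (le_ciSup (f := fun t => ∑ j, ((s j : ℤ) : ℝ) * g t j z.1)
        (bddAbove_range_of_abs_le fun t => hsb s t z.1) t)
      (le_ciSup (f := fun t => ∑ j, (((-s) j : ℤ) : ℝ) * g t j z.2)
        (bddAbove_range_of_abs_le fun t => hsb (-s) t z.2) t)
  calc _ ≤ _ := h1
    _ = _ := h2
    _ ≤ ∫ z : (κ → E) × (κ → E), ((⨆ t, ∑ j, ((s j : ℤ) : ℝ) * g t j z.1) +
      ⨆ t, ∑ j, (((-s) j : ℤ) : ℝ) * g t j z.2) ∂(Q.prod Q) :=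
        integral_mono (hmp.integrable_comp_of_integrable hΨi)
          (((hsi s).comp_fst Q).add ((hsi (-s)).comp_snd Q)) h3
    _ = _ := by
      rw [integral_add ((hsi s).comp_fst Q) ((hsi (-s)).comp_snd Q)]
      rw [integral_fun_fst (fun x => ⨆ t, ∑ j, ((s j : ℤ) : ℝ) * g t j x),
        integral_fun_snd (fun x => ⨆ t, ∑ j, (((-s) j : ℤ) : ℝ) * g t j x)]
      simp

end Symmetrization

/-! ### Deviation inequality by counting arrangements of ghost samples -/

section GhostSamples

variable {κ ι E T : Type*} [Fintype ι]

/-- An exponential Markov bound for the number of agreements with `a₀`: each agreement gets weight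
`q + 1 = b ^ 4`, so every member of `S` has weight at least `b ^ card ι`. The total weight factors
over coordinates, each contributing `(q + 1) + q`. -/
theorem card_filter_agree_mul_le [DecidableEq ι] {b q : ℕ} (hq : q + 1 = b ^ 4)
    (a₀ : ι → Fin (q + 1)) (S : Finset (ι → Fin (q + 1)))
    (hS : ∀ a ∈ S, Fintype.card ι ≤ 4 * (Finset.univ.filter fun j => a j = a₀ j).card) :
    S.card * b ^ Fintype.card ι ≤ (2 * (q + 1)) ^ Fintype.card ι := by
  have hb : 0 < b := by
    rcases Nat.eq_zero_or_pos b with h | h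
    · simp [h] at hq
    · exact h
  calc S.card * b ^ Fintype.card ι = ∑ a ∈ S, b ^ Fintype.card ι := by simp
    _ ≤ ∑ a ∈ S, ∏ j, (if a j = a₀ j then q + 1 else 1) := by
        refine Finset.sum_le_sum fun a ha => ?_
        rw [Finset.prod_ite]
        simp only [Finset.prod_const, one_pow, mul_one]
        refine (Nat.pow_le_pow_right hb (hS a ha)).trans ?_
        rw [pow_mul, ← hq]
    _ ≤ ∑ a : ι → Fin (q + 1), ∏ j, (if a j = a₀ j then q + 1 else 1) :=
        Finset.sum_le_sum_of_subset (Finset.subset_univ _)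
    _ = ∏ j, ∑ l : Fin (q + 1), (if l = a₀ j then q + 1 else 1) := by
        rw [Finset.prod_univ_sum, Fintype.piFinset_univ]
    _ ≤ ∏ _j : ι, (2 * (q + 1)) := by
        refine Finset.prod_le_prod' fun j _ => ?_
        rw [Finset.sum_ite]
        simp only [Finset.sum_const, smul_eq_mul, mul_one]
        have h1 : (Finset.univ.filter fun l => l = a₀ j).card = 1 := by
          simp [Finset.filter_eq']
        have h2 : (Finset.univ.filter fun l => ¬ l = a₀ j).card ≤ q + 1 := by
          simpa using Finset.card_filter_le (Finset.univ : Finset (Fin (q + 1))) _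
        rw [h1]
        omega
    _ = _ := by simp

open Classical in
/-- The samples for which some `t` has at least half of the blocks bad. -/
def manyBad (D : T → ι → (κ → E) → Prop) : Set (κ → E) :=
  {w | ∃ t, Fintype.card ι ≤ 2 * (Finset.univ.filter fun j => D t j w).card}

open Classical in
/-- The `q`-tuples of samples for which every `t` has fewer than `card ι / 4` bad blocks in total. -/
def fewBad (q : ℕ) (D : T → ι → (κ → E) → Prop) : Set (κ → Fin q → E) :=
  {x | ∀ t, 4 * (Finset.univ.filter
    fun jl : ι × Fin q => D t jl.1 (fun i => x i jl.2)).card < Fintype.card ι}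

/-- Openness gives measurability although `T` is uncountable: a union over `t` of open sets needs no
countability. -/
theorem isOpen_manyBad [TopologicalSpace E] {D : T → ι → (κ → E) → Prop}
    (hD : ∀ t j, IsOpen {w | D t j w}) : IsOpen (manyBad D) := by
  classical
  have : manyBad D = ⋃ t, ⋃ J : Finset ι, ⋃ _ : Fintype.card ι ≤ 2 * J.card,
      ⋂ j ∈ J, {w | D t j w} := by
    ext w
    simp only [manyBad, Set.mem_ofPred_eq, Set.mem_iUnion, Set.mem_iInter, exists_prop]
    refine exists_congr fun t => ⟨fun h => ⟨_, h, fun j hj => (Finset.mem_filter.1 hj).2⟩, ?_⟩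
    rintro ⟨J, hJ, h⟩
    refine hJ.trans (Nat.mul_le_mul_left 2 (Finset.card_le_card fun j hj => ?_))
    simpa using h j hj
  rw [this]
  exact isOpen_iUnion fun t => isOpen_iUnion fun J => isOpen_iUnion fun _ =>
    isOpen_biInter_finset fun j _ => hD t j

theorem isClosed_fewBad [TopologicalSpace E] {q : ℕ} {D : T → ι → (κ → E) → Prop}
    (hD : ∀ t j, IsOpen {w | D t j w}) : IsClosed (fewBad q D) := by
  classical
  have : (fewBad q D)ᶜ = ⋃ t, ⋃ J : Finset (ι × Fin q), ⋃ _ : Fintype.card ι ≤ 4 * J.card,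
      ⋂ jl ∈ J, (fun (x : κ → Fin q → E) i => x i jl.2) ⁻¹' {w | D t jl.1 w} := by
    ext x
    simp only [fewBad, Set.mem_compl_iff, Set.mem_ofPred_eq, Set.mem_iUnion, Set.mem_iInter,
      exists_prop, not_forall, not_lt, Set.mem_preimage]
    refine exists_congr fun t => ⟨fun h => ⟨_, h, fun j hj => (Finset.mem_filter.1 hj).2⟩, ?_⟩
    rintro ⟨J, hJ, h⟩
    refine hJ.trans (Nat.mul_le_mul_left 4 (Finset.card_le_card fun j hj => ?_))
    simpa using h j hj
  rw [← isOpen_compl_iff, this]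
  exact isOpen_iUnion fun t => isOpen_iUnion fun J => isOpen_iUnion fun _ =>
    isOpen_biInter_finset fun jl _ => (hD t jl.1).preimage (by fun_prop)

/-- For every coordinate `i`, exchanges the samples numbered `0` and `c i`. -/
def rowSwap {q : ℕ} (c : κ → Fin (q + 1)) (x : κ → Fin (q + 1) → E) : κ → Fin (q + 1) → E :=
  fun i l => x i (Equiv.swap 0 (c i) l)

open Classical in
-- Take `t` with at least half of the blocks bad in the arrangement `a`. A bad block with `a j ≠ a₀
-- j` uses a copy that is a ghost in the arrangement `a₀`, and there are fewer than a quarter of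
-- such blocks. The remaining bad blocks are agreements.
theorem card_le_four_mul_card_agree {q : ℕ} {blk : κ → ι} {D : T → ι → (κ → E) → Prop}
    (hD : ∀ t j w w', (∀ i, blk i = j → w i = w' i) → D t j w → D t j w')
    {x : κ → Fin (q + 1) → E} {a a₀ : ι → Fin (q + 1)}
    (ha : (fun i => rowSwap (a ∘ blk) x i 0) ∈ manyBad D)
    (ha₀ : (fun i (l : Fin q) => rowSwap (a₀ ∘ blk) x i l.succ) ∈ fewBad q D) :
    Fintype.card ι ≤ 4 * (Finset.univ.filter fun j => a j = a₀ j).card := by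
  obtain ⟨t, ht⟩ := ha
  have h0 := ha₀ t
  set S := Finset.univ.filter fun j => D t j (fun i => rowSwap (a ∘ blk) x i 0)
  set P := Finset.univ.filter
    fun jl : ι × Fin q => D t jl.1 (fun i => rowSwap (a₀ ∘ blk) x i jl.2.succ)
  have hdis : (S.filter fun j => ¬ a j = a₀ j).card ≤ P.card := by
    have hne : ∀ j ∈ S.filter fun j => ¬ a j = a₀ j,
        ∃ l : Fin q, (j, l) ∈ P := by
      intro j hj
      simp only [S, Finset.mem_filter, Finset.mem_univ, true_and] at hj
      -- The copy `a j` sits at position `Equiv.swap 0 (a₀ j) (a j)` of the arrangement `a₀`; it is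
      -- a ghost there unless this position is `0`.
      have h1 : Equiv.swap 0 (a₀ j) (a j) ≠ 0 := by
        intro h
        apply hj.2
        have := congrArg (Equiv.swap 0 (a₀ j)) h
        simpa using this
      obtain ⟨l, hl⟩ := Fin.exists_succ_eq.2 h1
      refine ⟨l, ?_⟩
      simp only [P, Finset.mem_filter, Finset.mem_univ, true_and]
      refine hD t j _ _ (fun i hi => ?_) hj.1
      subst hi
      simp [rowSwap, hl]
    refine (Finset.card_le_card fun j hj => ?_).trans (Finset.card_image_le (f := Prod.fst))
    obtain ⟨l, hl⟩ := hne j hj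
    exact Finset.mem_image.2 ⟨(j, l), hl, rfl⟩
  have hag : (S.filter fun j => a j = a₀ j).card ≤
      (Finset.univ.filter fun j => a j = a₀ j).card :=
    Finset.card_le_card (Finset.filter_subset_filter _ (Finset.subset_univ _))
  have := Finset.card_filter_add_card_filter_not (s := S) (fun j => a j = a₀ j)
  omega

variable [Fintype κ] [MeasurableSpace E]

theorem measurePreserving_rowSwap (ν : Measure E) [IsProbabilityMeasure ν] {q : ℕ}
    (c : κ → Fin (q + 1)) :
    MeasurePreserving (rowSwap (E := E) c)
      (Measure.pi fun _ : κ => Measure.pi fun _ : Fin (q + 1) => ν)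
      (Measure.pi fun _ : κ => Measure.pi fun _ : Fin (q + 1) => ν) := by
  refine measurePreserving_pi
    (f := fun i (y : Fin (q + 1) → E) l => y (Equiv.swap 0 (c i) l)) _ _ fun i => ?_
  have := measurePreserving_piCongrLeft (α := fun _ => E) (fun _ : Fin (q + 1) => ν)
    (Equiv.swap 0 (c i))
  convert this using 1
  funext y l
  obtain ⟨l', rfl⟩ := (Equiv.swap 0 (c i)).surjective l
  simp [MeasurableEquiv.piCongrLeft]

theorem measurePreserving_zero_succ (ν : Measure E) [IsProbabilityMeasure ν] (q : ℕ) :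
    MeasurePreserving
      (fun x : κ → Fin (q + 1) → E => ((fun i => x i 0), fun i (l : Fin q) => x i l.succ))
      (Measure.pi fun _ : κ => Measure.pi fun _ : Fin (q + 1) => ν)
      ((Measure.pi fun _ : κ => ν).prod
        (Measure.pi fun _ : κ => Measure.pi fun _ : Fin q => ν)) :=
  (measurePreserving_arrowProdEquivProdArrow E (Fin q → E) κ (fun _ => ν)
    (fun _ => Measure.pi fun _ => ν)).comp
    (measurePreserving_pi _ _ fun _ =>
      measurePreserving_piFinSuccAbove (fun _ : Fin (q + 1) => ν) 0)

/-- A deviation inequality for the number of bad blocks, by comparison with `q` ghost samples. -/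
theorem measure_manyBad_mul_measure_fewBad_le (ν : Measure E) [IsProbabilityMeasure ν]
    {b q : ℕ} (hq : q + 1 = b ^ 4) {blk : κ → ι} {D : T → ι → (κ → E) → Prop}
    (hD : ∀ t j w w', (∀ i, blk i = j → w i = w' i) → D t j w → D t j w')
    (hm : MeasurableSet (manyBad D)) (hf : MeasurableSet (fewBad q D)) :
    (Measure.pi fun _ : κ => ν) (manyBad D) *
      (Measure.pi fun _ : κ => Measure.pi fun _ : Fin q => ν) (fewBad q D) *
        (b : ENNReal) ^ Fintype.card ι ≤ 2 ^ Fintype.card ι := by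
  classical
  set ρ := Measure.pi fun _ : κ => Measure.pi fun _ : Fin (q + 1) => ν with hρ
  set φ := fun x : κ → Fin (q + 1) → E => ((fun i => x i 0), fun i (l : Fin q) => x i l.succ)
  set A₀ : Set (κ → Fin (q + 1) → E) := φ ⁻¹' (manyBad D ×ˢ fewBad q D) with hA₀
  have hmA₀ : MeasurableSet A₀ := (measurePreserving_zero_succ ν q).measurable (hm.prod hf)
  have h1 : ρ A₀ = (Measure.pi fun _ : κ => ν) (manyBad D) *
      (Measure.pi fun _ : κ => Measure.pi fun _ : Fin q => ν) (fewBad q D) := by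
    rw [← Measure.prod_prod]
    exact (measurePreserving_zero_succ ν q).measure_preimage (hm.prod hf).nullMeasurableSet
  rw [← h1]
  set A : (ι → Fin (q + 1)) → Set (κ → Fin (q + 1) → E) := fun a => rowSwap (a ∘ blk) ⁻¹' A₀
    with hA
  have hmA : ∀ a, MeasurableSet (A a) := fun a =>
    (measurePreserving_rowSwap ν (a ∘ blk)).measurable hmA₀
  have h2 : ∀ a, ρ (A a) = ρ A₀ := fun a =>
    (measurePreserving_rowSwap ν (a ∘ blk)).measure_preimage hmA₀.nullMeasurableSet
  have hcount : ∀ x, (Finset.univ.filter fun a => x ∈ A a).card * b ^ Fintype.card ι ≤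
      (2 * (q + 1)) ^ Fintype.card ι := by
    intro x
    by_cases hx : ∃ a₀, x ∈ A a₀
    · obtain ⟨a₀, h₀⟩ := hx
      refine card_filter_agree_mul_le hq a₀ _ fun a ha => ?_
      exact card_le_four_mul_card_agree hD (Finset.mem_filter.1 ha).2.1 h₀.2
    · rw [Finset.filter_false_of_mem fun a _ h => hx ⟨a, h⟩]
      simp
  -- Double counting: the sum of the probabilities is the integral of the number of arrangements
  -- realizing the event, which is bounded pointwise.
  have h3 : (∑ a, ρ (A a)) * (b : ENNReal) ^ Fintype.card ι ≤
      (2 * (q + 1 : ENNReal)) ^ Fintype.card ι := by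
    have e : ∑ a, ρ (A a) = ∫⁻ x, ((Finset.univ.filter fun a => x ∈ A a).card : ENNReal) ∂ρ := by
      simp_rw [← lintegral_indicator_one (hmA _)]
      rw [← lintegral_finsetSum _ fun a _ => measurable_one.indicator (hmA a)]
      refine lintegral_congr fun x => ?_
      simp [Finset.sum_boole, Set.indicator_apply]
    rw [e, ← lintegral_mul_const']
    · calc _ ≤ ∫⁻ _x, (2 * (q + 1 : ENNReal)) ^ Fintype.card ι ∂ρ := by
            refine lintegral_mono fun x => ?_
            have := (Nat.cast_le (α := ENNReal)).2 (hcount x)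
            push_cast at this
            exact this
        _ = _ := by simp
    · exact ENNReal.pow_ne_top (ENNReal.natCast_ne_top b)
  simp only [h2, Finset.sum_const, Finset.card_univ, Fintype.card_fun, Fintype.card_fin,
    nsmul_eq_mul] at h3
  rw [mul_pow, mul_comm (2 ^ _), mul_assoc] at h3
  push_cast at h3
  refine (ENNReal.mul_le_mul_iff_right ?_ ?_).1 h3
  · exact pow_ne_zero _ (by simp)
  · exact ENNReal.pow_ne_top (by finiteness)

end GhostSamples

/-! ### Dual ball, Hahn–Banach and Krein–Milman -/

section Duality

variable {d : ℕ} {p : Seminorm ℝ (EuclideanSpace ℝ (Fin d))}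

theorem continuous_seminorm (p : Seminorm ℝ (EuclideanSpace ℝ (Fin d))) : Continuous p :=
  continuousOn_univ.1 (p.convexOn.continuousOn isOpen_univ)

theorem zero_mem_dualBall : (0 : EuclideanSpace ℝ (Fin d)) ∈ dualBall p := fun x _ => by simp

instance : Nonempty (dualBall p) := ⟨⟨0, zero_mem_dualBall⟩⟩

theorem inner_le_of_mem_dualBall (hp : ∀ x, p x = 0 → x = 0) {t : EuclideanSpace ℝ (Fin d)}
    (ht : t ∈ dualBall p) (x : EuclideanSpace ℝ (Fin d)) : inner ℝ t x ≤ p x := by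
  rcases (apply_nonneg p x).eq_or_lt with h | h
  · rw [hp x h.symm]; simp
  · have := ht ((p x)⁻¹ • x) (by
      rw [map_smul_eq_mul, Real.norm_of_nonneg (by positivity), inv_mul_cancel₀ h.ne'])
    rw [inner_smul_right, inv_mul_le_iff₀ h, mul_one] at this
    exact this

theorem abs_inner_le_of_mem_dualBall (hp : ∀ x, p x = 0 → x = 0)
    {t : EuclideanSpace ℝ (Fin d)} (ht : t ∈ dualBall p) (x : EuclideanSpace ℝ (Fin d)) :
    |inner ℝ t x| ≤ p x := by
  refine abs_le.2 ⟨?_, inner_le_of_mem_dualBall hp ht x⟩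
  have := inner_le_of_mem_dualBall hp ht (-x)
  rw [inner_neg_right, map_neg_eq_map] at this
  linarith

/-- Hahn–Banach: the functional `c • v ↦ c * p v` on the line through `v` is dominated by `p` and
extends with the same domination. -/
theorem exists_mem_dualBall_inner_eq (v : EuclideanSpace ℝ (Fin d)) :
    ∃ t ∈ dualBall p, inner ℝ t v = p v := by
  by_cases hv : v = 0
  · exact ⟨0, zero_mem_dualBall, by simp [hv]⟩
  obtain ⟨e, he⟩ : ∃ e : ℝ ≃ₗ[ℝ] (ℝ ∙ v), ∀ c, (e c : EuclideanSpace ℝ (Fin d)) = c • v :=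
    ⟨LinearEquiv.toSpanNonzeroSingleton ℝ _ v hv, fun _ => rfl⟩
  obtain ⟨g, hg, hgp⟩ := Module.Dual.exists_extension_of_le_seminorm_real (p := p)
    (ℝ ∙ v) (p v • e.symm.toLinearMap) (by
      intro x
      obtain ⟨c, rfl⟩ := e.surjective x
      simp only [LinearMap.smul_apply, LinearEquiv.coe_coe, LinearEquiv.symm_apply_apply,
        smul_eq_mul, he, map_smul_eq_mul, Real.norm_eq_abs]
      rw [mul_comm]
      exact mul_le_mul_of_nonneg_right (le_abs_self c) (apply_nonneg p v))
  set l : StrongDual ℝ (EuclideanSpace ℝ (Fin d)) := LinearMap.toContinuousLinearMap g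
  have hl : ∀ x, inner ℝ ((InnerProductSpace.toDual ℝ _).symm l) x = g x := fun x => by
    rw [InnerProductSpace.toDual_symm_apply]; rfl
  refine ⟨(InnerProductSpace.toDual ℝ _).symm l, fun x hx => ?_, ?_⟩
  · rw [hl]
    exact (le_abs_self _).trans ((hgp x).trans hx)
  · rw [hl]
    simpa [he] using hg (e 1)

theorem iSup_inner_eq (hp : ∀ x, p x = 0 → x = 0) (v : EuclideanSpace ℝ (Fin d)) :
    ⨆ t : dualBall p, inner ℝ (t : EuclideanSpace ℝ (Fin d)) v = p v := by
  refine le_antisymm (ciSup_le fun t => inner_le_of_mem_dualBall hp t.2 v) ?_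
  obtain ⟨t, ht, h⟩ := exists_mem_dualBall_inner_eq (p := p) v
  rw [← h]
  exact le_ciSup (f := fun t : dualBall p => inner ℝ (t : EuclideanSpace ℝ (Fin d)) v)
    (bddAbove_range_of_abs_le fun t => abs_inner_le_of_mem_dualBall hp t.2 v) ⟨t, ht⟩

theorem convex_dualBall : Convex ℝ (dualBall p) := by
  intro s hs t ht a b ha hb hab x hx
  rw [inner_add_left, real_inner_smul_left, real_inner_smul_left]
  have h1 := mul_le_mul_of_nonneg_left (hs x hx) ha
  have h2 := mul_le_mul_of_nonneg_left (ht x hx) hb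
  linarith

theorem isCompact_dualBall (hp : ∀ x, p x = 0 → x = 0) : IsCompact (dualBall p) := by
  obtain ⟨C, hC, hpC⟩ := p.bound_of_continuous_normedSpace (continuous_seminorm p)
  refine Metric.isCompact_of_isClosed_isBounded ?_ ?_
  · have : dualBall p = ⋂ x, ⋂ _ : p x ≤ 1, {t | inner ℝ t x ≤ 1} := by
      ext t; simp [dualBall]
    rw [this]
    exact isClosed_iInter fun x => isClosed_iInter fun _ =>
      isClosed_le (by fun_prop) continuous_const
  · refine (Metric.isBounded_closedBall (x := 0) (r := C)).subset fun t ht => ?_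
    rw [mem_closedBall_zero_iff]
    have h := (inner_le_of_mem_dualBall hp ht t).trans (hpC t)
    rw [real_inner_self_eq_norm_mul_norm] at h
    by_contra hlt
    push Not at hlt
    nlinarith [norm_nonneg t]

/-- A norming functional of `v` lies in the closed convex hull of the extreme points, and a closed
half-space containing them contains that hull. -/
theorem le_of_forall_extremePoints (hp : ∀ x, p x = 0 → x = 0) {v : EuclideanSpace ℝ (Fin d)}
    {r : ℝ} (h : ∀ t ∈ Set.extremePoints ℝ (dualBall p), inner ℝ t v ≤ r) : p v ≤ r := by
  obtain ⟨t, ht, hv⟩ := exists_mem_dualBall_inner_eq (p := p) v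
  rw [← hv]
  rw [← closure_convexHull_extremePoints (isCompact_dualBall hp) convex_dualBall] at ht
  have hcl : IsClosed {t : EuclideanSpace ℝ (Fin d) | inner ℝ t v ≤ r} :=
    isClosed_le (by fun_prop) continuous_const
  have hcv : Convex ℝ {t : EuclideanSpace ℝ (Fin d) | inner ℝ t v ≤ r} := by
    intro s hs t ht a b ha hb hab
    simp only [Set.mem_ofPred_eq] at hs ht ⊢
    rw [inner_add_left, real_inner_smul_left, real_inner_smul_left]
    have h1 := mul_le_mul_of_nonneg_left hs ha
    have h2 := mul_le_mul_of_nonneg_left ht hb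
    calc _ ≤ a * r + b * r := add_le_add h1 h2
      _ = r := by rw [← add_mul, hab, one_mul]
  exact closure_minimal (convexHull_min h hcv) hcl ht

end Duality

/-! ### Deterministic part: from few bad blocks to the estimate -/

section SlabIntersection

variable {d N n : ℕ} {p : Seminorm ℝ (EuclideanSpace ℝ (Fin d))}

/-- The deviation at `t` of the mean over the block `j` from `m` exceeds `r`. -/
def BlockDeviates (p : Seminorm ℝ (EuclideanSpace ℝ (Fin d))) (r : ℝ)
    (I : Fin n → Finset (Fin N)) (m : EuclideanSpace ℝ (Fin d)) (t : dualBall p) (j : Fin n)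
    (w : Fin N → EuclideanSpace ℝ (Fin d)) : Prop :=
  r < |inner ℝ (t : EuclideanSpace ℝ (Fin d)) (blockMean w (I j) - m)|

open Classical in
theorem mem_slabIntersection_and_forall_le (hp : ∀ x, p x = 0 → x = 0) {r : ℝ}
    {I : Fin n → Finset (Fin N)} {m : EuclideanSpace ℝ (Fin d)}
    {w : Fin N → EuclideanSpace ℝ (Fin d)} (hw : w ∉ manyBad (BlockDeviates p r I m)) :
    m ∈ slabIntersection p r I w ∧ ∀ y ∈ slabIntersection p r I w, p (y - m) ≤ 2 * r := by
  have hm : m ∈ slabIntersection p r I w := by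
    simp only [slabIntersection, Set.mem_iInter]
    intro t ht
    have h : ¬ Fintype.card (Fin n) ≤ 2 * (Finset.univ.filter fun j =>
        BlockDeviates p r I m ⟨t, extremePoints_subset ht⟩ j w).card := fun h => hw ⟨_, h⟩
    rw [Fintype.card_fin] at h
    have hc := Finset.card_filter_add_card_filter_not (s := (Finset.univ : Finset (Fin n)))
      (fun j => BlockDeviates p r I m ⟨t, extremePoints_subset ht⟩ j w)
    rw [Finset.card_univ, Fintype.card_fin] at hc
    simp only [BlockDeviates, not_lt, inner_sub_right] at hc h
    show (n : ℝ) / 2 < _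
    rw [div_lt_iff₀ two_pos]
    norm_cast
    omega
  refine ⟨hm, fun y hy => le_of_forall_extremePoints hp fun t ht => ?_⟩
  simp only [slabIntersection, Set.mem_iInter] at hm hy
  have h1 : (n : ℝ) / 2 < _ := hm t ht
  have h2 : (n : ℝ) / 2 < _ := hy t ht
  -- Two strict majorities among the `n` blocks meet; a common block puts both `m` and `y` within
  -- `r` of its mean along `t`.
  have h3 : ¬ Disjoint
      (Finset.univ.filter fun j : Fin n => |inner ℝ t (blockMean w (I j)) - inner ℝ t m| ≤ r)
      (Finset.univ.filter fun j : Fin n => |inner ℝ t (blockMean w (I j)) - inner ℝ t y| ≤ r) := by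
    intro hd
    have h4 := Finset.card_le_univ (Finset.disjUnion _ _ hd)
    rw [Finset.card_disjUnion, Fintype.card_fin] at h4
    have h5 : ((_ + _ : ℕ) : ℝ) ≤ n := Nat.cast_le.2 h4
    push_cast at h5
    linarith
  obtain ⟨j, hj1, hj2⟩ := Finset.not_disjoint_iff.1 h3
  have hj1 := abs_le.1 (Finset.mem_filter.1 hj1).2
  have hj2 := abs_le.1 (Finset.mem_filter.1 hj2).2
  rw [inner_sub_right]
  linarith [hj1.1, hj1.2, hj2.1, hj2.2]

theorem isOpen_setOf_blockDeviates {r : ℝ} {I : Fin n → Finset (Fin N)}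
    {m : EuclideanSpace ℝ (Fin d)} (t : dualBall p) (j : Fin n) :
    IsOpen {w | BlockDeviates p r I m t j w} := by
  unfold BlockDeviates blockMean
  exact isOpen_lt continuous_const (by fun_prop)

end SlabIntersection

/-! ### Variance of block means and norms of signed sums -/

section Moments

variable {d N n : ℕ} {p : Seminorm ℝ (EuclideanSpace ℝ (Fin d))}
  {ν : Measure (EuclideanSpace ℝ (Fin d))} [IsProbabilityMeasure ν]

theorem memLp_seminorm_sub (hν : MemLp id 2 ν) (m : EuclideanSpace ℝ (Fin d)) :
    MemLp (fun x => p (x - m)) 2 ν := by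
  obtain ⟨C, hC, hpC⟩ := p.bound_of_continuous_normedSpace (continuous_seminorm p)
  have h : MemLp (fun x => x - m) 2 ν := hν.sub (memLp_const m)
  refine h.of_le_mul (c := C) ?_ (Filter.Eventually.of_forall fun x => ?_)
  · exact ((continuous_seminorm p).comp (continuous_id.sub
      continuous_const)).measurable.aestronglyMeasurable
  · rw [Real.norm_of_nonneg (apply_nonneg _ _)]
    exact hpC _

theorem integrable_seminorm_sub (hν : MemLp id 2 ν) (m : EuclideanSpace ℝ (Fin d)) :
    Integrable (fun x => p (x - m)) ν :=
  (memLp_seminorm_sub hν m).integrable (by norm_num)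

theorem integrable_seminorm_eval_sub (hν : MemLp id 2 ν) (m : EuclideanSpace ℝ (Fin d))
    (i : Fin N) :
    Integrable (fun x : Fin N → EuclideanSpace ℝ (Fin d) => p (x i - m))
      (Measure.pi fun _ => ν) :=
  (measurePreserving_eval (fun _ : Fin N => ν) i).integrable_comp_of_integrable
    (integrable_seminorm_sub hν m)

theorem memLp_inner_sub (hν : MemLp id 2 ν) (t m : EuclideanSpace ℝ (Fin d)) :
    MemLp (fun x => inner ℝ t (x - m)) 2 ν :=
  (hν.sub (memLp_const m)).const_inner t

theorem integral_inner_sub_mean (hν : MemLp id 2 ν) (t : EuclideanSpace ℝ (Fin d)) :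
    ∫ x, inner ℝ t (x - mean ν) ∂ν = 0 := by
  have h : Integrable (fun x : EuclideanSpace ℝ (Fin d) => x) ν := hν.integrable (by norm_num)
  have h' : Integrable (fun x => x - mean ν) ν := h.sub (integrable_const _)
  rw [integral_inner h', integral_sub h (integrable_const _)]
  simp [mean]

theorem sqrt_integral_inner_sq_le_weakStd (hp : ∀ x, p x = 0 → x = 0) (hν : MemLp id 2 ν)
    {t : EuclideanSpace ℝ (Fin d)} (ht : t ∈ dualBall p) :
    Real.sqrt (∫ x, inner ℝ t (x - mean ν) ^ 2 ∂ν) ≤ weakStd p ν := by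
  refine le_csSup ⟨Real.sqrt (∫ x, p (x - mean ν) ^ 2 ∂ν), ?_⟩ ⟨t, ht, rfl⟩
  rintro _ ⟨s, hs, rfl⟩
  refine Real.sqrt_le_sqrt (integral_mono (memLp_inner_sub hν s _).integrable_sq
    (memLp_seminorm_sub hν _).integrable_sq fun x => ?_)
  exact sq_le_sq.2 ((abs_inner_le_of_mem_dualBall hp hs _).trans (le_abs_self _))

theorem weakStd_nonneg (hp : ∀ x, p x = 0 → x = 0) (hν : MemLp id 2 ν) : 0 ≤ weakStd p ν :=
  (Real.sqrt_nonneg _).trans (sqrt_integral_inner_sq_le_weakStd hp hν zero_mem_dualBall)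

theorem blockMean_sub {J : Finset (Fin N)} (hJ : J.Nonempty)
    (w : Fin N → EuclideanSpace ℝ (Fin d)) (m : EuclideanSpace ℝ (Fin d)) :
    blockMean w J - m = (J.card : ℝ)⁻¹ • ∑ i ∈ J, (w i - m) := by
  have : (J.card : ℝ) ≠ 0 := Nat.cast_ne_zero.2 hJ.card_ne_zero
  rw [blockMean, Finset.sum_sub_distrib, smul_sub, Finset.sum_const, ← Nat.cast_smul_eq_nsmul ℝ,
    inv_smul_smul₀ this]

theorem integral_abs_inner_blockMean_sub_le (hp : ∀ x, p x = 0 → x = 0) (hν : MemLp id 2 ν)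
    {J : Finset (Fin N)} (hJ : J.Nonempty) {t : EuclideanSpace ℝ (Fin d)}
    (ht : t ∈ dualBall p) :
    ∫ w, |inner ℝ t (blockMean w J - mean ν)| ∂(Measure.pi fun _ : Fin N => ν) ≤
      weakStd p ν / Real.sqrt J.card := by
  set Q := Measure.pi fun _ : Fin N => ν with hQ
  set f : EuclideanSpace ℝ (Fin d) → ℝ := fun x => inner ℝ t (x - mean ν) with hf
  have hfL : MemLp f 2 ν := memLp_inner_sub hν t _
  have hfi : ∀ i : Fin N, MemLp (fun w : Fin N → EuclideanSpace ℝ (Fin d) => f (w i)) 2 Q :=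
    fun i => hfL.comp_measurePreserving (measurePreserving_eval (fun _ : Fin N => ν) i)
  have hind : iIndepFun (fun (i : Fin N) (w : Fin N → EuclideanSpace ℝ (Fin d)) => f (w i)) Q :=
    iIndepFun_pi fun i => hfL.1.aemeasurable
  have hmean : ∀ i : Fin N, ∫ w, f (w i) ∂Q = 0 := fun i => by
    rw [integral_comp_eval (μ := fun _ : Fin N => ν) hfL.1]
    exact integral_inner_sub_mean hν t
  have hvarf : ∀ i : Fin N, Var[fun w : Fin N → EuclideanSpace ℝ (Fin d) => f (w i); Q] =
      ∫ x, f x ^ 2 ∂ν := fun i => by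
    rw [variance_eq_sub (hfi i), hmean]
    simp only [Pi.pow_apply, ne_eq, OfNat.ofNat_ne_zero, not_false_eq_true, zero_pow, sub_zero]
    exact integral_comp_eval (μ := fun _ : Fin N => ν) (f := fun x => f x ^ 2) (hfL.1.pow 2)
  set Y : (Fin N → EuclideanSpace ℝ (Fin d)) → ℝ := ∑ i ∈ J, fun w => f (w i) with hY
  have hYL : MemLp Y 2 Q := memLp_finsetSum' _ fun i _ => hfi i
  have hYv : Var[Y; Q] = J.card * ∫ x, f x ^ 2 ∂ν := by
    rw [hY, IndepFun.variance_sum (fun i _ => hfi i) fun i _ j _ hij => hind.indepFun hij]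
    simp [hvarf]
  have hY0 : ∫ w, Y w ∂Q = 0 := by
    simp only [hY, Finset.sum_apply]
    rw [integral_finsetSum _ fun i _ => (hfi i).integrable (by norm_num)]
    simp [hmean]
  have hsq : (∫ w, |Y w| ∂Q) ^ 2 ≤ J.card * ∫ x, f x ^ 2 ∂ν := by
    -- Nonnegativity of the variance of `|Y|` is the Cauchy–Schwarz bound `(E|Y|)² ≤ E Y²`.
    have h1 := variance_nonneg |Y| Q
    rw [variance_eq_sub hYL.abs] at h1
    have h2 : Var[Y; Q] = ∫ w, Y w ^ 2 ∂Q := by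
      rw [variance_eq_sub hYL, hY0]; simp
    simp only [Pi.pow_apply, Pi.abs_apply, sq_abs] at h1
    linarith
  have hc : (0 : ℝ) < J.card := Nat.cast_pos.2 hJ.card_pos
  have e : ∀ w : Fin N → EuclideanSpace ℝ (Fin d),
      |inner ℝ t (blockMean w J - mean ν)| = (J.card : ℝ)⁻¹ * |Y w| := by
    intro w
    rw [blockMean_sub hJ, inner_smul_right, inner_sum, abs_mul, abs_of_nonneg (by positivity)]
    simp [hY, hf]
  simp only [e]
  rw [integral_const_mul]
  have h3 : ∫ w, |Y w| ∂Q ≤ Real.sqrt J.card * weakStd p ν := by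
    refine (Real.le_sqrt_of_sq_le hsq).trans ?_
    rw [Real.sqrt_mul hc.le]
    exact mul_le_mul_of_nonneg_left (sqrt_integral_inner_sq_le_weakStd hp hν ht)
      (Real.sqrt_nonneg _)
  have hs : Real.sqrt J.card * Real.sqrt J.card = J.card := Real.mul_self_sqrt hc.le
  have hs0 : 0 < Real.sqrt J.card := Real.sqrt_pos.2 hc
  rw [inv_mul_le_iff₀ hc, mul_div_assoc', le_div_iff₀ hs0]
  calc _ ≤ Real.sqrt J.card * weakStd p ν * Real.sqrt J.card :=
        mul_le_mul_of_nonneg_right h3 hs0.le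
    _ = _ := by rw [mul_right_comm, hs]

/-- The expected norm of the sum of the centred sample with coefficients `c`. -/
noncomputable def expNormSum (p : Seminorm ℝ (EuclideanSpace ℝ (Fin d)))
    (ν : Measure (EuclideanSpace ℝ (Fin d))) (c : Fin N → ℝ) : ℝ :=
  ∫ w, p (∑ i, c i • (w i - mean ν)) ∂(Measure.pi fun _ : Fin N => ν)

theorem seminorm_sum_smul_le {ι : Type*} (s : Finset ι) (c : ι → ℝ)
    (v : ι → EuclideanSpace ℝ (Fin d)) : p (∑ i ∈ s, c i • v i) ≤ ∑ i ∈ s, |c i| * p (v i) := by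
  refine (Finset.le_sum_of_subadditive p (map_zero p).le (map_add_le_add p) s _).trans
    (le_of_eq ?_)
  simp [map_smul_eq_mul]

theorem integrable_seminorm_sum (hν : MemLp id 2 ν) (c : Fin N → ℝ) :
    Integrable (fun w : Fin N → EuclideanSpace ℝ (Fin d) => p (∑ i, c i • (w i - mean ν)))
      (Measure.pi fun _ => ν) := by
  refine (integrable_finsetSum Finset.univ fun i _ =>
    (integrable_seminorm_eval_sub (p := p) hν (mean ν) i).const_mul |c i|).mono' ?_
    (Filter.Eventually.of_forall fun w => ?_)
  · exact ((continuous_seminorm p).comp (by fun_prop)).measurable.aestronglyMeasurable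
  · rw [Real.norm_of_nonneg (apply_nonneg _ _)]
    exact seminorm_sum_smul_le _ _ _

/-- Symmetrization applied to the centred functions `σ i * ⟪t, w i - μ⟫` with signs `σ * s`: the
factors `σ i` cancel and leave `s` and `-s`, which give the same norm. Thus any two sign patterns
are comparable. -/
theorem expNormSum_sign_le (hp : ∀ x, p x = 0 → x = 0) (hν : MemLp id 2 ν)
    (σ s : Fin N → ℤˣ) :
    expNormSum p ν (fun i => ((σ i : ℤ) : ℝ)) ≤ 2 * expNormSum p ν (fun i => ((s i : ℤ) : ℝ)) := by
  have h := integral_iSup_sum_sub_integral_le (T := dualBall p) ν (id : Fin N → Fin N)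
    (fun t i w => ((σ i : ℤ) : ℝ) * inner ℝ (t : EuclideanSpace ℝ (Fin d)) (w i - mean ν))
    (fun t i => by fun_prop) (fun t j w w' hw => by rw [hw j rfl])
    (fun i w => p (w i - mean ν)) (fun t i w => by
      rw [abs_mul, show |((σ i : ℤ) : ℝ)| = 1 by
        rcases Int.units_eq_one_or (σ i) with h | h <;> simp [h], one_mul]
      exact abs_inner_le_of_mem_dualBall hp t.2 _)
    (fun i => integrable_seminorm_eval_sub hν _ i) (σ * s)
  have hz : ∀ (t : dualBall p) (i : Fin N),
      ∫ y, ((σ i : ℤ) : ℝ) * inner ℝ (t : EuclideanSpace ℝ (Fin d)) (y i - mean ν)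
        ∂(Measure.pi fun _ : Fin N => ν) = 0 := fun t i => by
    rw [integral_const_mul, integral_comp_eval (μ := fun _ : Fin N => ν)
      (f := fun x => inner ℝ (t : EuclideanSpace ℝ (Fin d)) (x - mean ν))
      (memLp_inner_sub hν _ _).1, integral_inner_sub_mean hν, mul_zero]
  have hsum : ∀ (c : Fin N → ℝ) (w : Fin N → EuclideanSpace ℝ (Fin d)),
      ⨆ t : dualBall p, ∑ i, c i * inner ℝ (t : EuclideanSpace ℝ (Fin d)) (w i - mean ν) =
        p (∑ i, c i • (w i - mean ν)) := fun c w => by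
    rw [← iSup_inner_eq hp]
    simp [inner_sum, inner_smul_right]
  have hσ : ∀ i, ((σ i : ℤ) : ℝ) * ((σ i : ℤ) : ℝ) = 1 := fun i => by
    rcases Int.units_eq_one_or (σ i) with h | h <;> simp [h]
  have e1 : ∀ i, (((σ * s) i : ℤ) : ℝ) * ((σ i : ℤ) : ℝ) = ((s i : ℤ) : ℝ) := fun i => by
    simp only [Pi.mul_apply, Units.val_mul, Int.cast_mul]
    linear_combination ((s i : ℤ) : ℝ) * hσ i
  have e2 : ∀ i, (((-(σ * s)) i : ℤ) : ℝ) * ((σ i : ℤ) : ℝ) = -((s i : ℤ) : ℝ) := fun i => by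
    rw [← e1]; simp
  simp only [hz, sub_zero, ← mul_assoc, e1, e2, hsum] at h
  have e3 : ∀ w : Fin N → EuclideanSpace ℝ (Fin d),
      p (∑ i, -((s i : ℤ) : ℝ) • (w i - mean ν)) = p (∑ i, ((s i : ℤ) : ℝ) • (w i - mean ν)) :=
    fun w => by simp only [neg_smul, Finset.sum_neg_distrib, map_neg_eq_map]
  simp only [e3] at h
  simp only [expNormSum]
  linarith

instance : IsProbabilityMeasure rademacher := ⟨by
  simp [rademacher, ENNReal.inv_two_add_inv_two]⟩

theorem ae_rademacher : ∀ᵐ e ∂rademacher, e = 1 ∨ e = -1 := by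
  rw [rademacher, ae_add_measure_iff]
  have h : MeasurableSet {e : ℝ | e = 1 ∨ e = -1} :=
    (measurableSet_singleton 1).union (measurableSet_singleton (-1))
  constructor <;> refine Measure.ae_smul_measure ?_ _ <;> rw [ae_dirac_iff h] <;> simp

/-- A lower bound valid for every sign vector survives averaging over random signs. -/
theorem le_sqrt_mul_expNormY (hN : 0 < N) (hν : MemLp id 2 ν) {K : ℝ}
    (hK : ∀ s : Fin N → ℤˣ, K ≤ expNormSum p ν (fun i => ((s i : ℤ) : ℝ))) :
    K ≤ Real.sqrt N * expNormY p ν N := by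
  have hs : 0 < Real.sqrt N := Real.sqrt_pos.2 (Nat.cast_pos.2 hN)
  set F : (Fin N → ℝ) × (Fin N → EuclideanSpace ℝ (Fin d)) → ℝ := fun z =>
    p ((Real.sqrt N)⁻¹ • ∑ i, z.1 i • (z.2 i - mean ν)) with hF
  have hFe : ∀ z, F z = (Real.sqrt N)⁻¹ * p (∑ i, z.1 i • (z.2 i - mean ν)) := fun z => by
    simp only [hF, map_smul_eq_mul]
    rw [Real.norm_of_nonneg (by positivity)]
  have hae : ∀ᵐ e ∂(Measure.pi fun _ : Fin N => rademacher), ∀ i, e i = 1 ∨ e i = -1 :=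
    ae_all_iff.2 fun i => 
      (Measure.quasiMeasurePreserving_eval (fun _ : Fin N => rademacher) i).ae ae_rademacher
  have hFi : Integrable F ((Measure.pi fun _ : Fin N => rademacher).prod
      (Measure.pi fun _ : Fin N => ν)) := by
    have hb : Integrable (fun z : (Fin N → ℝ) × (Fin N → EuclideanSpace ℝ (Fin d)) =>
        (Real.sqrt N)⁻¹ * ∑ i, p (z.2 i - mean ν)) ((Measure.pi fun _ : Fin N => rademacher).prod
      (Measure.pi fun _ : Fin N => ν)) :=
      ((integrable_finsetSum _ fun i _ =>
        integrable_seminorm_eval_sub hν _ i).const_mul _).comp_snd _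
    refine hb.mono' ?_ ?_
    · exact ((continuous_seminorm p).comp (by fun_prop)).measurable.aestronglyMeasurable
    · have := (Measure.quasiMeasurePreserving_fst (μ := Measure.pi fun _ : Fin N => rademacher)
        (ν := Measure.pi fun _ : Fin N => ν)).ae hae
      filter_upwards [this] with z hz
      rw [Real.norm_of_nonneg (apply_nonneg _ _)]
      refine (hFe z).trans_le ?_
      refine mul_le_mul_of_nonneg_left ((seminorm_sum_smul_le _ _ _).trans
        (Finset.sum_le_sum fun i _ => ?_)) (by positivity)
      rcases hz i with h | h <;> simp [h]
  have h1 : ∀ᵐ e ∂(Measure.pi fun _ : Fin N => rademacher),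
      (Real.sqrt N)⁻¹ * K ≤ ∫ w, F (e, w) ∂(Measure.pi fun _ : Fin N => ν) := by
    filter_upwards [hae] with e he
    simp only [hFe]
    rw [integral_const_mul]
    refine mul_le_mul_of_nonneg_left ?_ (by positivity)
    have : e = fun i => (((if e i = 1 then (1 : ℤˣ) else -1 : ℤˣ) : ℤ) : ℝ) := by
      funext i
      rcases he i with h | h
      · simp [h]
      · have : ¬ (-1 : ℝ) = 1 := by norm_num
        simp [h, this]
    rw [this]
    exact hK _
  have h2 : (Real.sqrt N)⁻¹ * K ≤ expNormY p ν N := by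
    rw [expNormY, integral_prod F hFi]
    calc (Real.sqrt N)⁻¹ * K = ∫ _e, (Real.sqrt N)⁻¹ * K
          ∂(Measure.pi fun _ : Fin N => rademacher) := by simp
      _ ≤ _ := integral_mono_ae (integrable_const _) hFi.integral_prod_left h1
  rwa [inv_mul_le_iff₀ hs] at h2

end Moments

/-! ### Expected supremum of block deviations, and the ghost-sample event -/

section BlockMeans

variable {d N n : ℕ} {p : Seminorm ℝ (EuclideanSpace ℝ (Fin d))}
  {ν : Measure (EuclideanSpace ℝ (Fin d))} {I : Fin n → Finset (Fin N)}

theorem blockMean_congr {J : Finset (Fin N)} {w w' : Fin N → EuclideanSpace ℝ (Fin d)}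
    (h : ∀ i ∈ J, w i = w' i) : blockMean w J = blockMean w' J := by
  rw [blockMean, blockMean, Finset.sum_congr rfl h]

/-- Indices outside all blocks are sent to block `0`. This is harmless: the mean over `I j` still
depends only on coordinates with index `j`. -/
theorem IsBlockFamily.exists_index (hI : IsBlockFamily I) (hn : 0 < n) :
    ∃ blk : Fin N → Fin n, ∀ j, ∀ i ∈ I j, blk i = j := by
  classical
  refine ⟨fun i => if h : ∃ j, i ∈ I j then h.choose else ⟨0, hn⟩, fun j i hi => ?_⟩
  have h : ∃ j, i ∈ I j := ⟨j, hi⟩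
  simp only [h, dif_pos]
  by_contra hne
  exact Finset.disjoint_left.1 (hI.disjoint _ _ hne) h.choose_spec hi

theorem continuous_blockMean_sub (J : Finset (Fin N)) (m : EuclideanSpace ℝ (Fin d)) :
    Continuous fun w : Fin N → EuclideanSpace ℝ (Fin d) => blockMean w J - m := by
  unfold blockMean
  fun_prop

variable [IsProbabilityMeasure ν]

theorem integrable_seminorm_blockMean_sub (hν : MemLp id 2 ν) {J : Finset (Fin N)}
    (hJ : J.Nonempty) (m : EuclideanSpace ℝ (Fin d)) :
    Integrable (fun w : Fin N → EuclideanSpace ℝ (Fin d) => p (blockMean w J - m))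
      (Measure.pi fun _ => ν) := by
  refine (integrable_finsetSum J fun i _ =>
    (integrable_seminorm_eval_sub (p := p) hν m i).const_mul |(J.card : ℝ)⁻¹|).mono' ?_
    (Filter.Eventually.of_forall fun w => ?_)
  · exact ((continuous_seminorm p).comp
      (continuous_blockMean_sub J m)).measurable.aestronglyMeasurable
  · rw [Real.norm_of_nonneg (apply_nonneg _ _), blockMean_sub hJ, Finset.smul_sum]
    exact seminorm_sum_smul_le _ _ _

theorem integral_seminorm_sum_blockMean_le (hp : ∀ x, p x = 0 → x = 0) (hν : MemLp id 2 ν)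
    (hI : IsBlockFamily I) (hn : 0 < n) (hnN : n ≤ N) (s : Fin n → ℤˣ) :
    ∫ w, p (∑ j, ((s j : ℤ) : ℝ) • (blockMean w (I j) - mean ν))
        ∂(Measure.pi fun _ : Fin N => ν) ≤
      2 * ((N / n : ℕ) : ℝ)⁻¹ * (Real.sqrt N * expNormY p ν N) := by
  classical
  have hm : 0 < N / n := Nat.div_pos hnN hn
  obtain ⟨blk, hblk⟩ := hI.exists_index hn
  set C := Finset.univ.biUnion I with hC
  set σ : Fin N → ℤˣ := fun i => s (blk i) with hσ
  -- The blocks need not exhaust the sample. The signs `σ` and `σ'` agree on their union and are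
  -- opposite elsewhere, so half the sum of the two full signed sums is the sum over the blocks.
  set σ' : Fin N → ℤˣ := fun i => if i ∈ C then s (blk i) else - s (blk i) with hσ'
  have e : ∀ w : Fin N → EuclideanSpace ℝ (Fin d),
      ∑ j, ((s j : ℤ) : ℝ) • (blockMean w (I j) - mean ν) = (((N / n : ℕ) : ℝ)⁻¹ * 2⁻¹) •
        (∑ i, ((σ i : ℤ) : ℝ) • (w i - mean ν) + ∑ i, ((σ' i : ℤ) : ℝ) • (w i - mean ν)) := by
    intro w
    have h1 : ∀ j, ((s j : ℤ) : ℝ) • (blockMean w (I j) - mean ν) =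
        ((N / n : ℕ) : ℝ)⁻¹ • ∑ i ∈ I j, ((σ i : ℤ) : ℝ) • (w i - mean ν) := by
      intro j
      have hJ : (I j).Nonempty := Finset.card_pos.1 (by rw [hI.card_eq]; exact hm)
      rw [blockMean_sub hJ, hI.card_eq, smul_comm, Finset.smul_sum]
      congr 1
      refine Finset.sum_congr rfl fun i hi => ?_
      simp only [hσ, hblk j i hi]
    simp only [h1]
    rw [← Finset.smul_sum, ← Finset.sum_biUnion fun j _ k _ hjk => hI.disjoint j k hjk, mul_smul]
    congr 1
    rw [eq_inv_smul_iff₀ two_ne_zero, ← Finset.sum_add_distrib, ← hC,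
      ← Finset.sum_subset (Finset.subset_univ C), Finset.smul_sum]
    · refine Finset.sum_congr rfl fun i hi => ?_
      simp only [hσ, hσ', hi, if_true]
      rw [two_smul]
    · intro i _ hi
      simp [hσ, hσ', hi]
  have hc : (0 : ℝ) < ((N / n : ℕ) : ℝ)⁻¹ := inv_pos.2 (Nat.cast_pos.2 hm)
  have hY : ∀ τ : Fin N → ℤˣ, 2⁻¹ * expNormSum p ν (fun i => ((τ i : ℤ) : ℝ)) ≤
      Real.sqrt N * expNormY p ν N := fun τ =>
    le_sqrt_mul_expNormY (hn.trans_le hnN) hν fun s' => by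
      have := expNormSum_sign_le hp hν τ s'
      linarith
  calc _ ≤ ∫ w, (((N / n : ℕ) : ℝ)⁻¹ * 2⁻¹) * (p (∑ i, ((σ i : ℤ) : ℝ) • (w i - mean ν)) +
        p (∑ i, ((σ' i : ℤ) : ℝ) • (w i - mean ν))) ∂(Measure.pi fun _ : Fin N => ν) := by
        refine integral_mono_of_nonneg (Filter.Eventually.of_forall fun w => apply_nonneg _ _)
          (((integrable_seminorm_sum hν _).add (integrable_seminorm_sum hν _)).const_mul _)
          (Filter.Eventually.of_forall fun w => ?_)
        simp only [e, map_smul_eq_mul]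
        rw [Real.norm_of_nonneg (by positivity)]
        exact mul_le_mul_of_nonneg_left (map_add_le_add p _ _) (by positivity)
    _ = (((N / n : ℕ) : ℝ)⁻¹ * 2⁻¹) * (expNormSum p ν (fun i => ((σ i : ℤ) : ℝ)) +
        expNormSum p ν (fun i => ((σ' i : ℤ) : ℝ))) := by
        rw [integral_const_mul, integral_add (integrable_seminorm_sum hν _)
          (integrable_seminorm_sum hν _)]
        rfl
    _ ≤ _ := by
        have h1 := hY σ
        have h2 := hY σ'
        rw [mul_assoc, mul_comm 2, mul_assoc]
        refine mul_le_mul_of_nonneg_left ?_ hc.le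
        linarith

/-- The supremum over the dual ball of the sums of the absolute block deviations from `m`. -/
noncomputable def supDeviation (p : Seminorm ℝ (EuclideanSpace ℝ (Fin d)))
    (I : Fin n → Finset (Fin N)) (m : EuclideanSpace ℝ (Fin d))
    (w : Fin N → EuclideanSpace ℝ (Fin d)) : ℝ :=
  ⨆ t : dualBall p, ∑ j, |inner ℝ (t : EuclideanSpace ℝ (Fin d)) (blockMean w (I j) - m)|

theorem sum_abs_inner_le (hp : ∀ x, p x = 0 → x = 0) (m : EuclideanSpace ℝ (Fin d))
    (w : Fin N → EuclideanSpace ℝ (Fin d)) (t : dualBall p) :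
    abs (∑ j, |inner ℝ (t : EuclideanSpace ℝ (Fin d)) (blockMean w (I j) - m)|) ≤
      ∑ j, p (blockMean w (I j) - m) := by
  rw [abs_of_nonneg (Finset.sum_nonneg fun j _ => abs_nonneg _)]
  exact Finset.sum_le_sum fun j _ => abs_inner_le_of_mem_dualBall hp t.2 _

theorem sum_abs_inner_le_supDeviation (hp : ∀ x, p x = 0 → x = 0)
    (m : EuclideanSpace ℝ (Fin d)) (w : Fin N → EuclideanSpace ℝ (Fin d)) (t : dualBall p) :
    ∑ j, |inner ℝ (t : EuclideanSpace ℝ (Fin d)) (blockMean w (I j) - m)| ≤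
      supDeviation p I m w :=
  le_ciSup (f := fun t : dualBall p =>
    ∑ j, |inner ℝ (t : EuclideanSpace ℝ (Fin d)) (blockMean w (I j) - m)|)
    (bddAbove_range_of_abs_le fun t => sum_abs_inner_le hp m w t) t

theorem supDeviation_nonneg (hp : ∀ x, p x = 0 → x = 0) (m : EuclideanSpace ℝ (Fin d))
    (w : Fin N → EuclideanSpace ℝ (Fin d)) : 0 ≤ supDeviation p I m w :=
  (Finset.sum_nonneg fun _ _ => abs_nonneg _).trans
    (sum_abs_inner_le_supDeviation hp m w ⟨0, zero_mem_dualBall⟩)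

theorem integrable_supDeviation (hp : ∀ x, p x = 0 → x = 0) (hν : MemLp id 2 ν)
    (hI : ∀ j, (I j).Nonempty) (m : EuclideanSpace ℝ (Fin d)) :
    Integrable (supDeviation p I m) (Measure.pi fun _ => ν) :=
  integrable_iSup (fun _ => continuous_finsetSum _ fun j _ =>
      (continuous_const.inner (continuous_blockMean_sub (I j) m)).abs)
    (fun t w => sum_abs_inner_le hp m w t)
    (integrable_finsetSum _ fun j _ => integrable_seminorm_blockMean_sub hν (hI j) m)

theorem integral_supDeviation_le (hp : ∀ x, p x = 0 → x = 0) (hν : MemLp id 2 ν)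
    (hI : IsBlockFamily I) (hn : 0 < n) (hnN : n ≤ N) :
    ∫ w, supDeviation p I (mean ν) w ∂(Measure.pi fun _ : Fin N => ν) ≤
      n * (weakStd p ν / Real.sqrt ((N / n : ℕ) : ℝ)) +
        4 * ((N / n : ℕ) : ℝ)⁻¹ * (Real.sqrt N * expNormY p ν N) := by
  classical
  have hm : 0 < N / n := Nat.div_pos hnN hn
  have hJ : ∀ j, (I j).Nonempty := fun j => Finset.card_pos.1 (by rw [hI.card_eq]; exact hm)
  obtain ⟨blk, hblk⟩ := hI.exists_index hn
  set Q := Measure.pi fun _ : Fin N => ν with hQ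
  set z : Fin n → (Fin N → EuclideanSpace ℝ (Fin d)) → EuclideanSpace ℝ (Fin d) :=
    fun j w => blockMean w (I j) - mean ν with hz
  set g : dualBall p → Fin n → (Fin N → EuclideanSpace ℝ (Fin d)) → ℝ :=
    fun t j w => |inner ℝ (t : EuclideanSpace ℝ (Fin d)) (z j w)| with hg
  have hzc : ∀ j, Continuous (z j) := fun j => continuous_blockMean_sub (I j) _
  have hgc : ∀ t j, Continuous (g t j) := fun t j => (continuous_const.inner (hzc j)).abs
  have hgB : ∀ t j w, |g t j w| ≤ p (z j w) := fun t j w => by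
    rw [hg, abs_abs]; exact abs_inner_le_of_mem_dualBall hp t.2 _
  have hBi : ∀ j, Integrable (fun w => p (z j w)) Q := fun j =>
    integrable_seminorm_blockMean_sub hν (hJ j) _
  have hsumB : Integrable (fun w => ∑ j, p (z j w)) Q := integrable_finsetSum _ fun j _ => hBi j
  have hgi : ∀ t j, Integrable (g t j) Q := fun t j =>
    (hBi j).mono' (hgc t j).measurable.aestronglyMeasurable
      (Filter.Eventually.of_forall fun w => hgB t j w)
  set K := 2 * ((N / n : ℕ) : ℝ)⁻¹ * (Real.sqrt N * expNormY p ν N) with hK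
  set L := ∫ w, ⨆ t, ∑ j, (g t j w - ∫ y, g t j y ∂Q) ∂Q with hL
  have hsym : ∀ s : Fin n → ℤˣ, L ≤ (∫ w, ⨆ t, ∑ j, ((s j : ℤ) : ℝ) * g t j w ∂Q) +
      ∫ w, ⨆ t, ∑ j, (((-s) j : ℤ) : ℝ) * g t j w ∂Q := by
    refine integral_iSup_sum_sub_integral_le ν blk g hgc (fun t j w w' h => ?_)
      (fun j w => p (z j w)) hgB hBi
    simp only [hg, hz]
    rw [blockMean_congr fun i hi => h i (hblk j i hi)]
  have hA : ∀ s : Fin n → ℤˣ,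
      Integrable (fun w => ⨆ t, ∑ j, ((s j : ℤ) : ℝ) * g t j w) Q := fun s =>
    integrable_iSup (fun t => by fun_prop) (fun t w => (Finset.abs_sum_le_sum_abs _ _).trans
      (Finset.sum_le_sum fun j _ => by
        rw [abs_mul, show |((s j : ℤ) : ℝ)| = 1 by
          rcases Int.units_eq_one_or (s j) with h | h <;> simp [h], one_mul]
        exact hgB t j w)) hsumB
  have hpi : ∀ s : Fin n → ℤˣ, Integrable (fun w => p (∑ j, ((s j : ℤ) : ℝ) • z j w)) Q := by
    intro s
    refine hsumB.mono' ((continuous_seminorm p).comp (by fun_prop)).measurable.aestronglyMeasurable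
      (Filter.Eventually.of_forall fun w => ?_)
    rw [Real.norm_of_nonneg (apply_nonneg _ _)]
    refine (seminorm_sum_smul_le _ _ _).trans (Finset.sum_le_sum fun j _ => ?_)
    rcases Int.units_eq_one_or (s j) with h | h <;> simp [h]
  have hAsum : ∑ s : Fin n → ℤˣ, ∫ w, ⨆ t, ∑ j, ((s j : ℤ) : ℝ) * g t j w ∂Q ≤
      ∑ _s : Fin n → ℤˣ, K := by
    calc _ = ∫ w, ∑ s : Fin n → ℤˣ, ⨆ t, ∑ j, ((s j : ℤ) : ℝ) * g t j w ∂Q :=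
          (integral_finsetSum _ fun s _ => hA s).symm
      _ ≤ ∫ w, ∑ s : Fin n → ℤˣ, p (∑ j, ((s j : ℤ) : ℝ) • z j w) ∂Q := by
          refine integral_mono (integrable_finsetSum _ fun s _ => hA s)
            (integrable_finsetSum _ fun s _ => hpi s) fun w => ?_
          refine (sum_iSup_sign_abs_le (B := fun j => p (z j w)) fun t j =>
            abs_inner_le_of_mem_dualBall hp t.2 (z j w)).trans (le_of_eq ?_)
          refine Finset.sum_congr rfl fun s _ => ?_
          rw [← iSup_inner_eq hp]
          simp [inner_sum, inner_smul_right]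
      _ = ∑ s : Fin n → ℤˣ, ∫ w, p (∑ j, ((s j : ℤ) : ℝ) • z j w) ∂Q :=
          integral_finsetSum _ fun s _ => hpi s
      _ ≤ _ := Finset.sum_le_sum fun s _ => integral_seminorm_sum_blockMean_le hp hν hI hn hnN s
  -- The symmetrization bound is averaged over all block signs; `s ↦ -s` permutes them, so both
  -- terms have the same average, at most `K`.
  have hLK : L ≤ 2 * K := by
    have h1 : ∑ _s : Fin n → ℤˣ, L ≤ _ := Finset.sum_le_sum fun s _ => hsym s
    have h2 : ∑ s : Fin n → ℤˣ, ∫ w, ⨆ t, ∑ j, (((-s) j : ℤ) : ℝ) * g t j w ∂Q =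
        ∑ s : Fin n → ℤˣ, ∫ w, ⨆ t, ∑ j, ((s j : ℤ) : ℝ) * g t j w ∂Q :=
      Equiv.sum_comp (Equiv.neg (Fin n → ℤˣ))
        fun s => ∫ w, ⨆ t, ∑ j, ((s j : ℤ) : ℝ) * g t j w ∂Q
    rw [Finset.sum_add_distrib, h2] at h1
    rw [Finset.sum_const, nsmul_eq_mul] at h1 hAsum
    have hcard : (0 : ℝ) < (Finset.univ : Finset (Fin n → ℤˣ)).card :=
      Nat.cast_pos.2 (Finset.card_pos.2 Finset.univ_nonempty)
    refine le_of_mul_le_mul_left ?_ hcard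
    linarith
  set R := weakStd p ν / Real.sqrt ((N / n : ℕ) : ℝ) with hR
  have hgR : ∀ t j, ∫ y, g t j y ∂Q ≤ R := fun t j => by
    have := integral_abs_inner_blockMean_sub_le hp hν (hJ j) t.2
    rw [hI.card_eq] at this
    exact this
  have hcb : ∀ t w, |∑ j, (g t j w - ∫ y, g t j y ∂Q)| ≤
      ∑ j, p (z j w) + ∑ j, ∫ y, p (z j y) ∂Q := by
    intro t w
    rw [← Finset.sum_add_distrib]
    refine (Finset.abs_sum_le_sum_abs _ _).trans (Finset.sum_le_sum fun j _ =>
      (abs_sub _ _).trans (add_le_add (hgB t j w) ?_))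
    exact abs_integral_le_integral_abs.trans (integral_mono (hgi t j).abs (hBi j) fun y => hgB t j y)
  have hci : Integrable (fun w => ⨆ t, ∑ j, (g t j w - ∫ y, g t j y ∂Q)) Q :=
    integrable_iSup (fun t => by fun_prop) hcb (hsumB.add (integrable_const _))
  have hpt : ∀ w, supDeviation p I (mean ν) w ≤
      (⨆ t, ∑ j, (g t j w - ∫ y, g t j y ∂Q)) + n * R := by
    intro w
    refine ciSup_le fun t => ?_
    have h1 := le_ciSup (f := fun t => ∑ j, (g t j w - ∫ y, g t j y ∂Q))
      (bddAbove_range_of_abs_le fun t => hcb t w) t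
    have h2 : ∑ j, ∫ y, g t j y ∂Q ≤ n * R :=
      (Finset.sum_le_sum fun j _ => hgR t j).trans (by simp)
    simp only [Finset.sum_sub_distrib] at h1 ⊢
    show ∑ j, g t j w ≤ _
    linarith
  calc _ ≤ ∫ w, ((⨆ t, ∑ j, (g t j w - ∫ y, g t j y ∂Q)) + n * R) ∂Q :=
        integral_mono (integrable_supDeviation hp hν hJ _) (hci.add (integrable_const _)) hpt
    _ = L + n * R := by
        rw [integral_add hci (integrable_const _)]; simp [hL]
    _ ≤ _ := by rw [hK] at hLK; linarith

/-- Markov's inequality for `S`, the sum of `supDeviation` over the ghost samples: a functional with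
at least `n / 4` bad blocks forces `S > r * n / 4`, which is at least twice the mean of `S`. -/
theorem half_le_measure_fewBad (hp : ∀ x, p x = 0 → x = 0) (hν : MemLp id 2 ν)
    (hI : ∀ j, (I j).Nonempty) (hn : 0 < n) (m : EuclideanSpace ℝ (Fin d)) {q : ℕ} {r : ℝ}
    (hr : 0 ≤ r)
    (hM : 8 * (q * ∫ w, supDeviation p I m w ∂(Measure.pi fun _ : Fin N => ν)) ≤ r * n) :
    2⁻¹ ≤ (Measure.pi fun _ : Fin N => Measure.pi fun _ : Fin q => ν)
      (fewBad q (BlockDeviates p r I m)) := by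
  classical
  set Q' := Measure.pi fun _ : Fin N => Measure.pi fun _ : Fin q => ν with hQ'
  have hmp : ∀ l : Fin q, MeasurePreserving
      (fun (x : Fin N → Fin q → EuclideanSpace ℝ (Fin d)) i => x i l) Q'
      (Measure.pi fun _ => ν) := fun l =>
    measurePreserving_pi _ _ fun _ => measurePreserving_eval (fun _ : Fin q => ν) l
  set S : (Fin N → Fin q → EuclideanSpace ℝ (Fin d)) → ℝ :=
    fun x => ∑ l, supDeviation p I m (fun i => x i l) with hS
  have hHi := integrable_supDeviation hp hν hI m
  have hSl : ∀ l : Fin q, Integrable (fun x : Fin N → Fin q → EuclideanSpace ℝ (Fin d) =>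
      supDeviation p I m (fun i => x i l)) Q' := fun l =>
    (hmp l).integrable_comp_of_integrable hHi
  have hSi : Integrable S Q' := integrable_finsetSum _ fun l _ => hSl l
  have hS0 : ∀ x, 0 ≤ S x := fun x => Finset.sum_nonneg fun l _ => supDeviation_nonneg hp m _
  have hSint : ∫ x, S x ∂Q' =
      q * ∫ w, supDeviation p I m w ∂(Measure.pi fun _ : Fin N => ν) := by
    rw [integral_finsetSum _ fun l _ => hSl l]
    have : ∀ l : Fin q, ∫ x, supDeviation p I m (fun i => x i l) ∂Q' =
        ∫ w, supDeviation p I m w ∂(Measure.pi fun _ : Fin N => ν) := fun l => by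
      rw [← (hmp l).map_eq, integral_map (hmp l).measurable.aemeasurable]
      rw [(hmp l).map_eq]
      exact hHi.1
    simp [this]
  rw [← hSint] at hM
  set u : ℝ := r * n / 4 with hu
  have hsub : (fewBad q (BlockDeviates p r I m))ᶜ ⊆ {x | u < S x} := by
    intro x hx
    simp only [fewBad, Set.mem_compl_iff, Set.mem_ofPred_eq, not_forall, not_lt,
      Fintype.card_fin] at hx
    obtain ⟨t, ht⟩ := hx
    set J := Finset.univ.filter fun jl : Fin n × Fin q =>
      BlockDeviates p r I m t jl.1 (fun i => x i jl.2) with hJ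
    have hJn : J.Nonempty := Finset.card_pos.1 (by omega)
    have h1 : (n : ℝ) ≤ 4 * J.card := by exact_mod_cast ht
    have h2 : u ≤ J.card * r := by rw [hu]; nlinarith
    have h3 : J.card * r < ∑ jl ∈ J, |inner ℝ (t : EuclideanSpace ℝ (Fin d))
        (blockMean (fun i => x i jl.2) (I jl.1) - m)| := by
      rw [← nsmul_eq_mul, ← Finset.sum_const]
      exact Finset.sum_lt_sum_of_nonempty hJn fun jl hjl => (Finset.mem_filter.1 hjl).2
    have h4 : ∑ jl ∈ J, |inner ℝ (t : EuclideanSpace ℝ (Fin d))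
        (blockMean (fun i => x i jl.2) (I jl.1) - m)| ≤ S x := by
      refine (Finset.sum_le_sum_of_subset_of_nonneg (Finset.subset_univ J)
        fun _ _ _ => abs_nonneg _).trans ?_
      rw [Fintype.sum_prod_type_right]
      exact Finset.sum_le_sum fun l _ => sum_abs_inner_le_supDeviation hp m (fun i => x i l) t
    exact h2.trans_lt (h3.trans_le h4)
  have hmeas : MeasurableSet (fewBad q (BlockDeviates p r I m)) :=
    (isClosed_fewBad fun t j => isOpen_setOf_blockDeviates t j).measurableSet
  have hcompl : Q' (fewBad q (BlockDeviates p r I m))ᶜ ≤ 2⁻¹ := by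
    -- For `r = 0` the Markov threshold vanishes; then `S` has integral zero, hence is zero almost
    -- everywhere.
    rcases hr.eq_or_lt with h0 | h0
    · have hu0 : u = 0 := by rw [hu, ← h0]; simp
      have hz : ∫ x, S x ∂Q' = 0 :=
        le_antisymm (by rw [← h0] at hM; linarith) (integral_nonneg hS0)
      have hae := (integral_eq_zero_iff_of_nonneg hS0 hSi).1 hz
      refine (le_of_eq (measure_mono_null hsub ?_)).trans zero_le
      rw [hu0]
      refine measure_mono_null (fun x hx => ?_) (ae_iff.1 hae)
      exact ne_of_gt hx
    · have hu0 : 0 < u := by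
        have : (0 : ℝ) < n := Nat.cast_pos.2 hn
        positivity
      have h1 := mul_meas_ge_le_integral_of_nonneg (Filter.Eventually.of_forall hS0) hSi u
      have h2 : Q'.real {x | u ≤ S x} ≤ 2⁻¹ := by
        refine le_of_mul_le_mul_left ?_ hu0
        rw [hu] at h1 ⊢
        linarith
      have h3 : Q' {x | u ≤ S x} ≤ 2⁻¹ := by
        rw [← ENNReal.ofReal_toReal (measure_ne_top Q' {x | u ≤ S x})]
        refine (ENNReal.ofReal_le_ofReal h2).trans (le_of_eq ?_)
        rw [ENNReal.ofReal_inv_of_pos two_pos]; simp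
      exact (measure_mono (hsub.trans fun x (hx : u < S x) => hx.le)).trans h3
  have h := prob_add_prob_compl (μ := Q') hmeas
  by_contra hlt
  push Not at hlt
  have : Q' (fewBad q (BlockDeviates p r I m)) + Q' (fewBad q (BlockDeviates p r I m))ᶜ <
      2⁻¹ + 2⁻¹ := ENNReal.add_lt_add_of_lt_of_le (by finiteness) hlt hcompl
  rw [h, ENNReal.inv_two_add_inv_two] at this
  exact lt_irrefl _ this

end BlockMeans

/-! ### Numerical constants and conclusion -/

theorem numBlocks_bounds {δ : ℝ} (h0 : 0 < δ) (h1 : δ < 1) :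
    0 < numBlocks δ ∧ Real.log (2 / δ) ≤ numBlocks δ ∧
      (numBlocks δ : ℝ) ≤ 5 / 2 * Real.log (2 / δ) := by
  have hL : Real.log 2 < Real.log (2 / δ) :=
    Real.log_lt_log two_pos (by rw [lt_div_iff₀ h0]; linarith)
  have h2 := Real.log_two_gt_d9
  refine ⟨Nat.ceil_pos.2 (by linarith), Nat.le_ceil _, ?_⟩
  -- Rounding up costs less than `1`, and `1 < 3/2 * log 2`, whence the factor `5/2`.
  have := Nat.ceil_lt_add_one (a := Real.log (2 / δ)) (by linarith)
  unfold numBlocks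
  linarith

theorem le_two_mul_mul_div {N n : ℕ} (hn : 0 < n) (hnN : n ≤ N) : N ≤ 2 * n * (N / n) := by
  have h1 := Nat.div_add_mod N n
  have h2 := Nat.mod_lt N hn
  have h3 := Nat.div_pos hnN hn
  nlinarith

theorem integral_supDeviation_le_mul_max {d N n : ℕ}
    {p : Seminorm ℝ (EuclideanSpace ℝ (Fin d))} (hp : ∀ x, p x = 0 → x = 0)
    {ν : Measure (EuclideanSpace ℝ (Fin d))} [IsProbabilityMeasure ν] (hν : MemLp id 2 ν)
    {I : Fin n → Finset (Fin N)} (hI : IsBlockFamily I) (hn : 0 < n) (hnN : n ≤ N) {L : ℝ}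
    (hL : (n : ℝ) ≤ 5 / 2 * L) :
    ∫ w, supDeviation p I (mean ν) w ∂(Measure.pi fun _ : Fin N => ν) ≤
      11 * (n / Real.sqrt N *
        max (expNormY p ν N) (expNormG p ν + weakStd p ν * Real.sqrt L)) := by
  have hn' : (0 : ℝ) < n := Nat.cast_pos.2 hn
  have hN' : (0 : ℝ) < N := Nat.cast_pos.2 (hn.trans_le hnN)
  have hm : (0 : ℝ) < ((N / n : ℕ) : ℝ) := Nat.cast_pos.2 (Nat.div_pos hnN hn)
  set m : ℝ := ((N / n : ℕ) : ℝ) with hmdef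
  have hNm : (N : ℝ) ≤ 2 * n * m := by
    rw [hmdef]; exact_mod_cast le_two_mul_mul_div hn hnN
  set W := max (expNormY p ν N) (expNormG p ν + weakStd p ν * Real.sqrt L) with hW
  have hR := weakStd_nonneg hp hν
  have hY : 0 ≤ expNormY p ν N := integral_nonneg fun _ => apply_nonneg _ _
  have hG : 0 ≤ expNormG p ν := integral_nonneg fun _ => apply_nonneg _ _
  have hYW : expNormY p ν N ≤ W := le_max_left _ _
  have hRW : weakStd p ν * Real.sqrt L ≤ W :=
    (le_add_of_nonneg_left hG).trans (le_max_right _ _)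
  have hs : 0 < Real.sqrt N := Real.sqrt_pos.2 hN'
  have hsm : 0 < Real.sqrt m := Real.sqrt_pos.2 hm
  have h1 : weakStd p ν / Real.sqrt m ≤ 3 * (W / Real.sqrt N) := by
    -- `N ≤ 2 n m ≤ 5 L m ≤ 9 L m`.
    have h : Real.sqrt N ≤ 3 * Real.sqrt L * Real.sqrt m := by
      refine Real.sqrt_le_iff.2 ⟨by positivity, ?_⟩
      have hL0 : 0 ≤ L := by linarith
      rw [mul_pow, mul_pow, Real.sq_sqrt hL0, Real.sq_sqrt hm.le]
      nlinarith
    rw [← mul_div_assoc, div_le_div_iff₀ hsm hs]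
    calc weakStd p ν * Real.sqrt N ≤ weakStd p ν * (3 * Real.sqrt L * Real.sqrt m) :=
          mul_le_mul_of_nonneg_left h hR
      _ = 3 * (weakStd p ν * Real.sqrt L) * Real.sqrt m := by ring
      _ ≤ _ := by gcongr
  have h2 : m⁻¹ * (Real.sqrt N * expNormY p ν N) ≤ 2 * n * (W / Real.sqrt N) := by
    rw [inv_mul_le_iff₀ hm, mul_div_assoc', mul_div_assoc', le_div_iff₀ hs]
    calc Real.sqrt N * expNormY p ν N * Real.sqrt N
        = (Real.sqrt N * Real.sqrt N) * expNormY p ν N := by ring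
      _ = N * expNormY p ν N := by rw [Real.mul_self_sqrt hN'.le]
      _ ≤ (2 * n * m) * W := by gcongr
      _ = _ := by ring
  refine (integral_supDeviation_le hp hν hI hn hnN).trans ?_
  have h3 := mul_le_mul_of_nonneg_left h1 hn'.le
  have e : n / Real.sqrt N * W = n * (W / Real.sqrt N) := by ring
  rw [e, mul_assoc 4]
  -- The constant is `11 = 3 + 4 * 2`, from `h3` and four times `h2`.
  linarith

theorem two_mul_inv_three_pow_le {δ : ℝ} (h0 : 0 < δ) {n : ℕ} (hn : Real.log (2 / δ) ≤ n) :
    2 * ((3 : ℝ)⁻¹) ^ n ≤ δ := by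
  have h1 : (3 : ℝ)⁻¹ ≤ Real.exp (-1) := by
    rw [Real.exp_neg]
    exact inv_anti₀ (Real.exp_pos 1) (by linarith [Real.exp_one_lt_d9])
  have h2 : ((3 : ℝ)⁻¹) ^ n ≤ Real.exp (-Real.log (2 / δ)) := by
    refine (pow_le_pow_left₀ (by norm_num) h1 n).trans ?_
    rw [← Real.exp_nat_mul]
    exact Real.exp_le_exp.2 (by linarith)
  rw [Real.exp_neg, Real.exp_log (by positivity), inv_div] at h2
  linarith

/-- Outside an event of probability `δ`, each functional in the dual ball is close to its mean on
more than half of the blocks. -/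
theorem measure_manyBad_blockDeviates_le {d N n : ℕ}
    {p : Seminorm ℝ (EuclideanSpace ℝ (Fin d))} (hp : ∀ x, p x = 0 → x = 0)
    {ν : Measure (EuclideanSpace ℝ (Fin d))} [IsProbabilityMeasure ν] (hν : MemLp id 2 ν)
    {I : Fin n → Finset (Fin N)} (hI : IsBlockFamily I) (hn : 0 < n) (hnN : n ≤ N) {δ : ℝ}
    (hδ : 0 < δ) (hLn : Real.log (2 / δ) ≤ n) (hnL : (n : ℝ) ≤ 5 / 2 * Real.log (2 / δ))
    {ε : ℝ} (hε : 1000000 / Real.sqrt N * max (expNormY p ν N)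
      (expNormG p ν + weakStd p ν * Real.sqrt (Real.log (2 / δ))) ≤ ε) :
    (Measure.pi fun _ : Fin N => ν) (manyBad (BlockDeviates p (ε / 2) I (mean ν))) ≤
      ENNReal.ofReal δ := by
  have hn' : (0 : ℝ) < n := Nat.cast_pos.2 hn
  have hJ : ∀ j, (I j).Nonempty := fun j =>
    Finset.card_pos.1 (by rw [hI.card_eq]; exact Nat.div_pos hnN hn)
  have hM := integral_supDeviation_le_mul_max hp hν hI hn hnN hnL
  set W := max (expNormY p ν N) (expNormG p ν + weakStd p ν * Real.sqrt (Real.log (2 / δ)))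
  have hW0 : 0 ≤ W := (integral_nonneg fun _ => apply_nonneg _ _ :
    0 ≤ expNormY p ν N).trans (le_max_left _ _)
  have hε0 : 0 ≤ ε := le_trans (by positivity) hε
  set D := BlockDeviates p (ε / 2) I (mean ν) with hD
  have hopen : ∀ t j, IsOpen {w | D t j w} := fun t j => isOpen_setOf_blockDeviates t j
  have hfew : 2⁻¹ ≤ (Measure.pi fun _ : Fin N => Measure.pi fun _ : Fin 1295 => ν)
      (fewBad 1295 D) := by
    -- With `r = ε / 2` the requirement is `8 * 1295 * 11 = 113960 ≤ 500000`.
    refine half_le_measure_fewBad hp hν hJ hn _ (by positivity) ?_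
    have h1 : n * (1000000 / Real.sqrt N * W) ≤ n * ε := mul_le_mul_of_nonneg_left hε hn'.le
    have e : (n : ℝ) * (1000000 / Real.sqrt N * W) = 1000000 * (n / Real.sqrt N * W) := by ring
    have h2 : 0 ≤ n / Real.sqrt N * W := by positivity
    rw [e] at h1
    push_cast
    linarith
  obtain ⟨blk, hblk⟩ := hI.exists_index hn
  -- `b = 6` is chosen so that `(2 / b) ^ n = 3⁻ⁿ`, which is below `exp (-n)`; then `q = 6 ^ 4 - 1 =
  -- 1295`.
  have hdev := measure_manyBad_mul_measure_fewBad_le ν (b := 6) (q := 1295)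
    (by norm_num) (blk := blk) (D := D)
    (fun t j w w' h hd => by
      rw [hD, BlockDeviates] at hd ⊢
      rwa [← blockMean_congr fun i hi => h i (hblk j i hi)])
    (isOpen_manyBad hopen).measurableSet (isClosed_fewBad hopen).measurableSet
  rw [Fintype.card_fin] at hdev
  have hfin : (Measure.pi fun _ : Fin N => ν) (manyBad D) ≠ ⊤ := measure_ne_top _ _
  generalize (Measure.pi fun _ : Fin N => ν) (manyBad D) = a at hdev hfin ⊢
  have h1 : a * 2⁻¹ * (6 : ENNReal) ^ n ≤ 2 ^ n := by
    refine le_trans ?_ hdev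
    push_cast
    gcongr
  have h2 : a.toReal * 2⁻¹ * 6 ^ n ≤ 2 ^ n := by
    have := ENNReal.toReal_mono (by finiteness) h1
    simpa using this
  rw [← ENNReal.ofReal_toReal hfin]
  refine ENNReal.ofReal_le_ofReal (le_trans ?_ (two_mul_inv_three_pow_le hδ hLn))
  have h6 : (6 : ℝ) ^ n = 2 ^ n * 3 ^ n := by rw [← mul_pow]; norm_num
  rw [h6] at h2
  have h3 : a.toReal * 2⁻¹ * 3 ^ n ≤ 1 := by
    refine le_of_mul_le_mul_left ?_ (pow_pos two_pos n : (0 : ℝ) < 2 ^ n)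
    linarith
  rw [inv_pow, ← div_eq_mul_inv, le_div_iff₀ (by positivity)]
  linarith

end NormMean

theorem theorem1 :
    ∃ c c' : ℝ, 0 < c ∧ 0 < c' ∧
      ∀ (d : ℕ) (p : Seminorm ℝ (EuclideanSpace ℝ (Fin d))), (∀ x, p x = 0 → x = 0) →
      ∀ (ν : Measure (EuclideanSpace ℝ (Fin d))) [IsProbabilityMeasure ν], MemLp id 2 ν →
      ∀ (δ : ℝ), 0 < δ → δ < 1 →
      ∀ (N : ℕ), NormMean.numBlocks δ ≤ N →
      ∀ (I : Fin (NormMean.numBlocks δ) → Finset (Fin N)), NormMean.IsBlockFamily I →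
      ∀ (Ω : Type*) [MeasurableSpace Ω] (P : Measure Ω) [IsProbabilityMeasure P]
        (X : Fin N → Ω → EuclideanSpace ℝ (Fin d)),
        (∀ i, HasLaw (X i) ν P) → iIndepFun X P →
      ∀ (ε : ℝ),
        c / Real.sqrt N * max (NormMean.expNormY p ν N)
          (NormMean.expNormG p ν + NormMean.weakStd p ν * Real.sqrt (Real.log (2 / δ))) ≤ ε →
        P {ω | ¬ ((NormMean.slabIntersection p (ε / 2) I (fun i => X i ω)).Nonempty ∧
            ∀ y ∈ NormMean.slabIntersection p (ε / 2) I (fun i => X i ω),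
              p (y - NormMean.mean ν) ≤ ε)}
          ≤ ENNReal.ofReal (c' * δ) := by
  refine ⟨1000000, 1, by norm_num, one_pos, ?_⟩
  intro d p hp ν _ hν δ hδ0 hδ1 N hnN I hI Ω _ P _ X hX hind ε hε
  obtain ⟨hn, hLn, hnL⟩ := NormMean.numBlocks_bounds hδ0 hδ1
  have hbad := NormMean.measure_manyBad_blockDeviates_le hp hν hI hn hnN hδ0 hLn hnL hε
  have hXm : ∀ i, AEMeasurable (X i) P := fun i => (hX i).aemeasurable
  have hlaw : P.map (fun ω i => X i ω) = Measure.pi fun _ : Fin N => ν := by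
    rw [(iIndepFun_iff_map_fun_eq_pi_map hXm).1 hind]
    exact congrArg _ (funext fun i => (hX i).map_eq)
  rw [one_mul]
  refine le_trans ?_ hbad
  -- Only the open set `manyBad` has to be measurable; the failure event itself is merely contained
  -- in its preimage.
  rw [← hlaw, Measure.map_apply_of_aemeasurable (aemeasurable_pi_lambda _ hXm)
    (NormMean.isOpen_manyBad fun t j => NormMean.isOpen_setOf_blockDeviates t j).measurableSet]
  refine measure_mono fun ω hω => ?_
  by_contra hgood
  obtain ⟨hmem, hall⟩ := NormMean.mem_slabIntersection_and_forall_le hp hgood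
  exact hω ⟨⟨_, hmem⟩, fun y hy => (hall y hy).trans (by linarith)⟩
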